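/- An \((a,b)\)-module is a free \(\mathbb{C}[[b]]\)-module \(E\) of finite rank with a \(\mathbb{C}\)-linear operator \(a\) such that \(a S = S a + b^2 S'\) for all \(S\in\mathbb{C}[[b]]\); submodules (sub-\(\mathbb{C}[[b]]\)-modules stable under \(a\)), quotients and isomorphisms are understood to respect \(a\). Let \(E_\mu=\mathbb{C}[[b]]\,e\) with \(a e=\mu\, b e\). For \(\lambda\in\mathbb{Q}\cap\,]0,1]\) and \(N\in\mathbb{N}\) let \(\Xi_\lambda^{(N)}=\bigoplus_{j=0}^N\mathbb{C}[[b]]\,s^{\lambda-1}(\log s)^j\), where \(a\) is the multiplication by \(s\) and \(b\) is the primitive without constant. A fresco is a module isomorphic to the submodule generated by one element of \(\bigl(\bigoplus_{\lambda\in\Lambda}\Xi_\lambda^{(N)}\bigr)\otimes_{\mathbb{C}}V\), for some finite \(\Lambda\subset\mathbb{Q}\cap\,]0,1]\), some \(N\in\mathbb{N}\) and some finite dimensional complex vector space \(V\). An \((a,b)\)-module \(G\) has a simple pole when \(aG\subset bG\), and it is regular when it embeds in one with a simple pole; its saturation \(G^\sharp\) is the minimal such embedding, and its Bernstein polynomial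 is the minimal polynomial of \(-b^{-1}a\) acting on \(G^\sharp/bG^\sharp\). For \(\lambda\in\mathbb{Q}\cap\,]0,1]\), a regular \(G\) is \([\lambda]\)-primitive when all roots of its Bernstein polynomial lie in \(-\lambda+\mathbb{Z}\), and \(G_{[\lambda]}\) denotes the largest \([\lambda]\)-primitive submodule of \(G\). A module is semi-simple when it is isomorphic to a submodule of a finite direct sum of regular \((a,b)\)-modules of rank \(1\). A submodule \(F\subset G\) is normal when \(F\cap bG=bF\). A Jordan–Hölder sequence of \(G\) is a sequence \(0=F_0\subset F_1\subset\dots\subset F_k=G\) of normal submodules whose successive quotients have rank \(1\); it corresponds to \(\mu_1,\dots,\mu_k\) when \(F_j/F_{j-1}\simeq E_{\mu_j}\) for all \(j\in[1,k]\). Write \((\ast)\) for the condition that \(G\) admits a Jordan–Hölder sequence corresponding to rational numbers \(\mu_1,\dots,\mu_k\) such that the sequence \(\mu_j+j\), \(j\in[1,k]\), is strictly decreasing. **Proposition.** Let \(E\) be a fresco. 1. If \(E\) is \([\lambda]\)-primitive for some \(\lambda\in\mathbb{Q}\cap\,]0,1]\), then \(E\) is semi-simple if and only if \(E\) satisfies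 \((\ast)\). 2. \(E\) is semi-simple if and only if, for every \(\lambda\in\mathbb{Q}\cap\,]0,1]\), its \([\lambda]\)-primitive part \(E_{[\lambda]}\) is semi-simple; equivalently, if and only if, for every \(\lambda\in\mathbb{Q}\cap\,]0,1]\), \(E_{[\lambda]}\) satisfies \((\ast)\). -/

import Mathlib

open PowerSeries

noncomputable section

namespace Fresco

universe u v

/-! The indeterminate `X` of `ℂ⟦X⟧` plays the role of the operator `b`. -/

/-- A `ℂ⟦b⟧`-module with an additive operator `a` such that `a S = S a + b² S'` for `S ∈ ℂ⟦b⟧`.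
Taking `S` constant shows that `a` is `ℂ`-linear, and `S = b` gives `a b - b a = b²`. An
`(a,b)`-module is such a module which is moreover free and finite over `ℂ⟦b⟧`. -/
class ABAction (E : Type u) [AddCommGroup E] [Module ℂ⟦X⟧ E] where
  a : E →+ E
  a_smul : ∀ (S : ℂ⟦X⟧) (x : E), a (S • x) = S • a x + (X ^ 2 * derivative ℂ S) • x

section Basic

variable {E : Type u} [AddCommGroup E] [Module ℂ⟦X⟧ E] [ABAction E]
variable {E' : Type v} [AddCommGroup E'] [Module ℂ⟦X⟧ E'] [ABAction E']

/-- A `ℂ⟦b⟧`-linear map which commutes with `a`. -/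
def IsABLinear (f : E →ₗ[ℂ⟦X⟧] E') : Prop :=
  ∀ x, f (ABAction.a x) = ABAction.a (f x)

variable (E E') in
/-- Isomorphism of `ℂ⟦b⟧`-modules with operator `a`. -/
def ABIso : Prop :=
  ∃ f : E ≃ₗ[ℂ⟦X⟧] E', IsABLinear (f : E →ₗ[ℂ⟦X⟧] E')

variable (E) in
/-- Sub-`ℂ⟦b⟧`-modules stable under `a`. -/
structure ABSubmodule extends Submodule ℂ⟦X⟧ E where
  a_mem : ∀ x ∈ toSubmodule, ABAction.a x ∈ toSubmodule

/-- The induced structure on a submodule. -/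
instance instABSub (F : ABSubmodule E) : ABAction F.toSubmodule where
  a := (ABAction.a.comp F.toSubmodule.subtype.toAddMonoidHom).codRestrict
    F.toSubmodule.toAddSubgroup (fun x => F.a_mem x.1 x.2)
  a_smul S x := Subtype.ext (ABAction.a_smul S (x : E))

/-- The operator induced by `a` on the quotient by a submodule. -/
def quotA (F : ABSubmodule E) : E ⧸ F.toSubmodule →+ E ⧸ F.toSubmodule :=
  QuotientAddGroup.map F.toSubmodule.toAddSubgroup F.toSubmodule.toAddSubgroup
    ABAction.a (fun x hx => F.a_mem x hx)

/-- The induced structure on a quotient. -/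
instance instABQuot (F : ABSubmodule E) : ABAction (E ⧸ F.toSubmodule) where
  a := quotA F
  a_smul S x := by
    obtain ⟨x, rfl⟩ := Submodule.Quotient.mk_surjective _ x
    exact congrArg (Submodule.Quotient.mk (p := F.toSubmodule)) (ABAction.a_smul S x)

/-- For submodules `F`, `G` of `E`, the intersection `F ∩ G` as a submodule of `G`. -/
def ABSubmodule.restrictTo (F G : ABSubmodule E) : ABSubmodule G.toSubmodule where
  toSubmodule := F.toSubmodule.comap G.toSubmodule.subtype
  a_mem x hx := F.a_mem x.1 hx

/-- The quotient `G / F`, meant for `F ⊆ G`. -/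
abbrev SubQuot (F G : ABSubmodule E) : Type u :=
  G.toSubmodule ⧸ (F.restrictTo G).toSubmodule

/-- The submodule generated by one element: the smallest one that contains it. -/
def generatedBy (x : E) : ABSubmodule E where
  toSubmodule := sInf {H | x ∈ H ∧ ∀ y ∈ H, ABAction.a y ∈ H}
  a_mem y hy := by
    rw [Submodule.mem_sInf] at hy ⊢
    exact fun H hH => hH.2 y (hy H hH)

/-- The submodule `b F`. -/
def bImage (F : Submodule ℂ⟦X⟧ E) : Submodule ℂ⟦X⟧ E :=
  F.map (LinearMap.lsmul ℂ⟦X⟧ E X)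

/-- `F` is normal in `E` when `F ∩ b E = b F`. -/
def ABSubmodule.IsNormal (F : ABSubmodule E) : Prop :=
  F.toSubmodule ⊓ bImage ⊤ = bImage F.toSubmodule

variable (E) in
/-- `E` has a simple pole when `a E ⊆ b E`. -/
def HasSimplePole : Prop :=
  ∀ x : E, ∃ y : E, ABAction.a x = (X : ℂ⟦X⟧) • y

/-- Finite direct sums (products), with componentwise operations. -/
instance instABPi {ι : Type v} (G : ι → Type u) [∀ i, AddCommGroup (G i)]
    [∀ i, Module ℂ⟦X⟧ (G i)] [∀ i, ABAction (G i)] : ABAction (∀ i, G i) where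
  a := AddMonoidHom.pi fun i => (ABAction.a : G i →+ G i).comp (Pi.evalAddMonoidHom G i)
  a_smul S x := funext fun i => ABAction.a_smul S (x i)

end Basic

/-! ### The Bernstein polynomial -/

section SimplePole

variable (G : Type u) [AddCommGroup G] [Module ℂ⟦X⟧ G]

/-- The complex vector space `G / b G`. -/
def Fiber : Type u := G ⧸ (bImage ⊤ : Submodule ℂ⟦X⟧ G)

instance : AddCommGroup (Fiber G) :=
  inferInstanceAs (AddCommGroup (G ⧸ (bImage ⊤ : Submodule ℂ⟦X⟧ G)))

instance : Module ℂ⟦X⟧ (Fiber G) :=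
  inferInstanceAs (Module ℂ⟦X⟧ (G ⧸ (bImage ⊤ : Submodule ℂ⟦X⟧ G)))

instance : Module ℂ (Fiber G) := Module.compHom (Fiber G) (C : ℂ →+* ℂ⟦X⟧)

/-- The class modulo `b G`. -/
def Fiber.mk : G →ₗ[ℂ⟦X⟧] Fiber G := Submodule.mkQ (bImage ⊤ : Submodule ℂ⟦X⟧ G)

variable {G}

theorem b_cancel [Module.Free ℂ⟦X⟧ G] {x y : G} (h : (X : ℂ⟦X⟧) • x = (X : ℂ⟦X⟧) • y) :
    x = y :=
  smul_right_injective G (X_ne_zero (R := ℂ)) h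

variable [ABAction G]

/-- On a simple pole `(a,b)-module`, the operator `b⁻¹ a`. -/
def bInvA [Module.Free ℂ⟦X⟧ G] (h : HasSimplePole G) : G →+ G where
  toFun x := Classical.choose (h x)
  map_zero' := b_cancel (by rw [← Classical.choose_spec (h 0), map_zero, smul_zero])
  map_add' x y := b_cancel (by
    rw [← Classical.choose_spec (h (x + y)), map_add, smul_add,
      ← Classical.choose_spec (h x), ← Classical.choose_spec (h y)])

theorem b_bInvA [Module.Free ℂ⟦X⟧ G] (h : HasSimplePole G) (x : G) :
    (X : ℂ⟦X⟧) • bInvA h x = ABAction.a x :=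
  (Classical.choose_spec (h x)).symm

theorem bInvA_smul [Module.Free ℂ⟦X⟧ G] (h : HasSimplePole G) (S : ℂ⟦X⟧) (x : G) :
    bInvA h (S • x) = S • bInvA h x + (X * derivative ℂ S) • x := by
  apply b_cancel
  rw [b_bInvA, ABAction.a_smul, smul_add, smul_comm, b_bInvA, smul_smul, pow_two, mul_assoc]

/-- The endomorphism of the complex vector space `G / b G` induced by `- b⁻¹ a`. -/
def negBInvA [Module.Free ℂ⟦X⟧ G] (h : HasSimplePole G) : Module.End ℂ (Fiber G) where
  toFun := QuotientAddGroup.map (bImage ⊤ : Submodule ℂ⟦X⟧ G).toAddSubgroup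
    (bImage ⊤ : Submodule ℂ⟦X⟧ G).toAddSubgroup (-bInvA h) (by
      rintro _ ⟨y, -, rfl⟩
      refine ⟨-(bInvA h y + y), trivial, ?_⟩
      simp [bInvA_smul])
  map_add' := map_add _
  map_smul' c x := by
    obtain ⟨x, rfl⟩ := Submodule.Quotient.mk_surjective _ x
    refine congrArg (Submodule.Quotient.mk (p := (bImage ⊤ : Submodule ℂ⟦X⟧ G)))
      (?_ : -bInvA h ((C c : ℂ⟦X⟧) • x) = (C c : ℂ⟦X⟧) • -bInvA h x)
    simp [bInvA_smul]

/-- The Bernstein polynomial of a simple pole `(a,b)`-module: the minimal polynomial of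
`- b⁻¹ a` acting on `G / b G`. -/
def bernsteinOfSimplePole [Module.Free ℂ⟦X⟧ G] (h : HasSimplePole G) : Polynomial ℂ :=
  minpoly ℂ (negBInvA h)

end SimplePole

/-- A bundled `(a,b)`-module. As an `(a,b)`-module is isomorphic to one with underlying
`ℂ⟦b⟧`-module `ℂ⟦b⟧ⁿ`, nothing is lost by taking the underlying sets in `Type`. -/
structure ABMod where
  carrier : Type
  [grp : AddCommGroup carrier]
  [mod : Module ℂ⟦X⟧ carrier]
  [free : Module.Free ℂ⟦X⟧ carrier]
  [fin : Module.Finite ℂ⟦X⟧ carrier]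
  [ab : ABAction carrier]

attribute [instance] ABMod.grp ABMod.mod ABMod.free ABMod.fin ABMod.ab

section Regular

variable (E : Type u) [AddCommGroup E] [Module ℂ⟦X⟧ E] [ABAction E]

/-- `E` is regular when it embeds in a simple pole `(a,b)`-module (so that it is itself free
and finite over `ℂ⟦b⟧`). -/
def IsRegular : Prop :=
  ∃ (G : ABMod) (i : E →ₗ[ℂ⟦X⟧] G.carrier),
    HasSimplePole G.carrier ∧ IsABLinear i ∧ Function.Injective i

variable {E} in
/-- The embedding `i : E → G` in a simple pole `(a,b)`-module is the saturation of `E`: it is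
minimal, i.e. no proper simple pole submodule of `G` contains the image of `E`. -/
def IsSaturation (G : ABMod) (i : E →ₗ[ℂ⟦X⟧] G.carrier) : Prop :=
  HasSimplePole G.carrier ∧ IsABLinear i ∧ Function.Injective i ∧
    ∀ H : ABSubmodule G.carrier, LinearMap.range i ≤ H.toSubmodule →
      HasSimplePole H.toSubmodule → H.toSubmodule = ⊤

/-- `p` is the Bernstein polynomial of `E`, i.e. of the saturation of `E`. The saturation of a
regular `(a,b)`-module exists and is unique up to isomorphism, hence so is `p`. -/
def IsBernsteinPolynomial (p : Polynomial ℂ) : Prop :=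
  ∃ (G : ABMod) (i : E →ₗ[ℂ⟦X⟧] G.carrier) (h : HasSimplePole G.carrier),
    IsSaturation G i ∧ p = bernsteinOfSimplePole h

/-- `E` is `[Λ]`-primitive: it is regular, and all the roots of its Bernstein polynomial lie in
`-Λ + ℤ`. -/
def IsPrimitive (Λ : Set ℚ) : Prop :=
  IsRegular E ∧ ∀ p, IsBernsteinPolynomial E p → ∀ r : ℂ, p.IsRoot r →
    ∃ l ∈ Λ, ∃ n : ℤ, r = -(l : ℂ) + n

/-- The `[Λ]`-primitive part of `E`: the largest `[Λ]`-primitive submodule. -/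
def primitivePart (Λ : Set ℚ) : ABSubmodule E where
  toSubmodule := ⨆ F : {F : ABSubmodule E // IsPrimitive F.toSubmodule Λ}, F.1.toSubmodule
  a_mem x hx := by
    induction hx using Submodule.iSup_induction' with
    | mem F x hx => exact Submodule.mem_iSup_of_mem F (F.1.a_mem x hx)
    | zero => simp
    | add x y _ _ h1 h2 => rw [map_add]; exact Submodule.add_mem _ h1 h2

/-- `E` is semi-simple: it is (isomorphic to) a submodule of a finite direct sum of regular
`(a,b)`-modules of rank one. -/
def IsSemiSimple : Prop :=
  ∃ (n : ℕ) (G : Fin n → ABMod) (f : E →ₗ[ℂ⟦X⟧] (∀ i, (G i).carrier)),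
    (∀ i, IsRegular (G i).carrier ∧ Module.finrank ℂ⟦X⟧ (G i).carrier = 1) ∧
      IsABLinear f ∧ Function.Injective f

end Regular

/-! ### Standard modules -/

/-- The rank one module `E_c`: it is `ℂ⟦b⟧ e` with `a e = c b e`. -/
def RankOne (_c : ℂ) : Type := ℂ⟦X⟧

instance (c : ℂ) : AddCommGroup (RankOne c) := inferInstanceAs (AddCommGroup ℂ⟦X⟧)

instance (c : ℂ) : Module ℂ⟦X⟧ (RankOne c) := inferInstanceAs (Module ℂ⟦X⟧ ℂ⟦X⟧)

/-- The operator `S ↦ c b S + b² S'` on `ℂ⟦b⟧`. -/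
def rankOneA (c : ℂ) : ℂ⟦X⟧ →+ ℂ⟦X⟧ where
  toFun S := C c * X * S + X ^ 2 * derivative ℂ S
  map_zero' := by simp
  map_add' S T := by rw [map_add]; ring

theorem rankOneA_mul (c : ℂ) (S T : ℂ⟦X⟧) :
    rankOneA c (S * T) = S * rankOneA c T + X ^ 2 * derivative ℂ S * T := by
  change C c * X * (S * T) + X ^ 2 * derivative ℂ (S * T) =
    S * (C c * X * T + X ^ 2 * derivative ℂ T) + X ^ 2 * derivative ℂ S * T
  rw [Derivation.leibniz]
  simp only [smul_eq_mul]
  ring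

instance (c : ℂ) : ABAction (RankOne c) where
  a := (rankOneA c : ℂ⟦X⟧ →+ ℂ⟦X⟧)
  a_smul S T := rankOneA_mul c S T

/-- The module `⨁_{j ≤ N} ℂ⟦b⟧ s^{l-1} (log s)^j` of asymptotic expansions, where `a` is the
multiplication by `s` and `b` the primitive without constant. The component `f j` is the
coefficient in `ℂ⟦b⟧` of `e_j = s^{l-1} (log s)^j`. As the derivative of
`a e_j = s^l (log s)^j` is `l e_j + j e_{j-1}`, one has `a e_j = b (l e_j + j e_{j-1})`. -/
def Xi (_l : ℚ) (N : ℕ) : Type := Fin (N + 1) → ℂ⟦X⟧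

instance (l : ℚ) (N : ℕ) : AddCommGroup (Xi l N) :=
  inferInstanceAs (AddCommGroup (Fin (N + 1) → ℂ⟦X⟧))

instance (l : ℚ) (N : ℕ) : Module ℂ⟦X⟧ (Xi l N) :=
  inferInstanceAs (Module ℂ⟦X⟧ (Fin (N + 1) → ℂ⟦X⟧))

/-- The coefficient of `s^{l-1} (log s)^j` in `f`, zero for `j > N`. -/
def Xi.coef {l : ℚ} {N : ℕ} (f : Xi l N) (j : ℕ) : ℂ⟦X⟧ :=
  if h : j < N + 1 then f ⟨j, h⟩ else 0

theorem Xi.coef_add {l : ℚ} {N : ℕ} (f g : Xi l N) (j : ℕ) :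
    (f + g).coef j = f.coef j + g.coef j := by
  unfold Xi.coef; split_ifs
  · rfl
  · simp

theorem Xi.coef_smul {l : ℚ} {N : ℕ} (S : ℂ⟦X⟧) (f : Xi l N) (j : ℕ) :
    (S • f).coef j = S * f.coef j := by
  unfold Xi.coef; split_ifs
  · rfl
  · simp

instance (l : ℚ) (N : ℕ) : ABAction (Xi l N) where
  a := AddMonoidHom.mk' (fun f => (fun j : Fin (N + 1) =>
        X * (C (l : ℂ) * f.coef j + C ((j : ℂ) + 1) * f.coef (j + 1))
          + X ^ 2 * derivative ℂ (f.coef j) : Fin (N + 1) → ℂ⟦X⟧)) (fun f g => by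
      funext j
      change X * (C (l : ℂ) * (f + g).coef j + C ((j : ℂ) + 1) * (f + g).coef (j + 1))
          + X ^ 2 * derivative ℂ ((f + g).coef j) =
        (X * (C (l : ℂ) * f.coef j + C ((j : ℂ) + 1) * f.coef (j + 1))
          + X ^ 2 * derivative ℂ (f.coef j)) +
        (X * (C (l : ℂ) * g.coef j + C ((j : ℂ) + 1) * g.coef (j + 1))
          + X ^ 2 * derivative ℂ (g.coef j))
      rw [Xi.coef_add, Xi.coef_add, map_add (derivative ℂ)]; ring)
  a_smul S f := by
    funext j
    have hj : f.coef j = f j := dif_pos j.2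
    change X * (C (l : ℂ) * (S • f).coef j + C ((j : ℂ) + 1) * (S • f).coef (j + 1))
          + X ^ 2 * derivative ℂ ((S • f).coef j) =
        S * (X * (C (l : ℂ) * f.coef j + C ((j : ℂ) + 1) * f.coef (j + 1))
          + X ^ 2 * derivative ℂ (f.coef j)) + X ^ 2 * derivative ℂ S * f j
    rw [Xi.coef_smul, Xi.coef_smul, Derivation.leibniz, ← hj]
    simp only [smul_eq_mul]; ring

/-- The module `(⨁_{l ∈ Λ} Xi l N) ⊗ ℂ^p`. -/
abbrev XiSum (Λ : Finset ℚ) (N p : ℕ) : Type := Fin p → ∀ l : Λ, Xi l N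

section Main

variable (E : Type u) [AddCommGroup E] [Module ℂ⟦X⟧ E] [ABAction E]

/-- `E` is a fresco: it is isomorphic to the submodule generated by one element of
`(⨁_{l ∈ Λ} Xi l N) ⊗ V`, for some finite `Λ ⊆ ℚ ∩ ]0,1]`, some `N`, and some finite dimensional
complex vector space `V = ℂ^p`. -/
def IsFresco : Prop :=
  ∃ (Λ : Finset ℚ) (N p : ℕ) (φ : XiSum Λ N p),
    (∀ l ∈ Λ, 0 < l ∧ l ≤ 1) ∧ ABIso E (generatedBy φ).toSubmodule

variable {E} in
/-- `0 = F_0 ⊆ F_1 ⊆ ... ⊆ F_k = E` is a Jordan–Hölder sequence: the `F_j` are normal and the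
successive quotients have rank one. -/
structure IsJordanHolder {k : ℕ} (F : Fin (k + 1) → ABSubmodule E) : Prop where
  bot : (F 0).toSubmodule = ⊥
  top : (F (Fin.last k)).toSubmodule = ⊤
  mono : ∀ j : Fin k, (F j.castSucc).toSubmodule ≤ (F j.succ).toSubmodule
  normal : ∀ j, (F j).IsNormal
  rank_one : ∀ j : Fin k, Module.finrank ℂ⟦X⟧ (SubQuot (F j.castSucc) (F j.succ)) = 1

/-- `E` has a Jordan–Hölder sequence with quotients `E_{μ_1}, ..., E_{μ_k}` such that the sequence
`μ_j + j` is strictly decreasing (the index `j : Fin k` stands for `j + 1 ∈ [1,k]`). -/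
def HasStrictlyDecreasingJH : Prop :=
  ∃ (k : ℕ) (F : Fin (k + 1) → ABSubmodule E) (μ : Fin k → ℚ),
    IsJordanHolder F ∧
    (∀ j : Fin k, ABIso (SubQuot (F j.castSucc) (F j.succ)) (RankOne (μ j : ℂ))) ∧
    StrictAnti (fun j : Fin k => μ j + ((j : ℕ) + 1 : ℚ))

end Main

end Fresco

end

/-! A fresco `E` embeds in a module of asymptotic expansions, in which `D = b⁻¹ a` acts on the
coefficients of `bⁿ s^{l-1} (log s)^j` through a Jordan block with eigenvalue `l + n`. Everything
is read off from this embedding.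

*Semi-simple means without logarithms.* On a regular module of rank one `D` is a scalar modulo `b`,
so that a polynomial in `D` with simple roots kills a sum of such modules modulo a given power
of `b`. The divisibility of `P(D)` by a power of `b` is, up to a bounded loss, independent of the
embedding (`exists_transfer`), and such a polynomial only kills expansions without logarithms
(`IsSemiSimple.logDeriv_comp_eq_zero`). Conversely the coefficients of an expansion without
logarithms are functionals with values in the modules `E_l`, which make the module semi-simple
(`isSemiSimple_of_functionals`).

*Primitive parts.* The same transfer, between the saturation and the module of expansions, shows
that the `[l]`-primitive part consists of the elements with exponents in `l - 1 + ℕ`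
(`mem_primitivePart_iff`). The projections on the components are limits of polynomials in `D`, so
that they map `E` to its primitive parts up to a power of `b` (`XiSum.proj_mem`). Hence `E` is
semi-simple as soon as its primitive parts are.

*From semi-simple to decreasing sequences.* Let `E` be generated by `x` and have no logarithm. The
kernel of a functional `g : E → E_c` with `g x = bⁿ` is generated by `(a - (c + n) b) x`
(`exists_generatedBy_inf_ker`). Eliminating the functionals with `c ≠ l` shows that the
`[l]`-primitive part is generated by one element. Eliminating next the functionals with `c = l`,
always one of minimal order `n`, gives a Jordan–Hölder sequence from the top; as
`a - (l + n) b` raises the orders at least to `n + 2`, the numbers `μ_j + j` strictly decrease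
(`exists_isTriangular`).

*From decreasing sequences to semi-simple.* The inequalities `μ_i + i > μ_j + j` for `i < j` are
what is needed to solve over `ℂ⟦b⟧` the equations which correct `b^{j-1} e_j` to an eigenvector
of `D`, where `e_j` lifts a generator of the `j`-th quotient
(`HasStrictlyDecreasingJH.isSemiSimple`). This holds for all torsion-free modules, in particular for
the primitive parts. -/

noncomputable section

namespace Fresco

universe u v w

/-! ### Polynomials in `b⁻¹ a` -/

theorem coeff_X_mul_derivative (n : ℕ) (S : ℂ⟦X⟧) :
    coeff n (X * derivative ℂ S) = (n : ℂ) * coeff n S := by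
  rcases n with _ | n
  · simp
  · rw [coeff_succ_X_mul, coeff_derivative]
    push_cast
    ring

theorem smul_X_pow_cancel {G : Type*} [AddCommGroup G] [Module ℂ⟦X⟧ G] [Module.Free ℂ⟦X⟧ G]
    {n : ℕ} {x y : G} (h : (X ^ n : ℂ⟦X⟧) • x = (X ^ n : ℂ⟦X⟧) • y) : x = y :=
  smul_right_injective G (pow_ne_zero n (X_ne_zero (R := ℂ))) h

section PolyD

variable {E : Type u} [AddCommGroup E] [Module ℂ⟦X⟧ E] [ABAction E]
variable {G : Type v} [AddCommGroup G] [Module ℂ⟦X⟧ G] [ABAction G]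
variable {H : Type w} [AddCommGroup H] [Module ℂ⟦X⟧ H] [ABAction H]

theorem X_sq_mul_derivative_X_pow (n : ℕ) :
    (X ^ 2 * derivative ℂ (X ^ n) : ℂ⟦X⟧) = C (n : ℂ) * X ^ (n + 1) := by
  rw [Derivation.leibniz_pow]
  rcases n with _ | n
  · simp
  · simp [derivative_X]
    ring

theorem a_X_pow_smul (n : ℕ) (x : E) :
    ABAction.a ((X ^ n : ℂ⟦X⟧) • x) =
      (X ^ n : ℂ⟦X⟧) • (ABAction.a x + (C (n : ℂ) * X : ℂ⟦X⟧) • x) := by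
  rw [ABAction.a_smul, X_sq_mul_derivative_X_pow, smul_add, smul_smul]
  congr 2
  ring

variable [Module.Free ℂ⟦X⟧ G] [Module.Free ℂ⟦X⟧ H]

theorem bInvA_X_pow_smul (h : HasSimplePole G) (n : ℕ) (x : G) :
    bInvA h ((X ^ n : ℂ⟦X⟧) • x) =
      (X ^ n : ℂ⟦X⟧) • (bInvA h x + (C (n : ℂ) : ℂ⟦X⟧) • x) := by
  apply b_cancel
  rw [b_bInvA, a_X_pow_smul, ← b_bInvA h x, smul_comm (X : ℂ⟦X⟧), smul_add X, smul_smul X (C _),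
    mul_comm X]

/-- Evaluation of complex polynomials at the operator `b⁻¹ a` of a simple pole `(a,b)`-module.
The operator is only additive over `ℂ⟦b⟧`, so the value is an additive endomorphism; the constant
`c` acts as multiplication by the constant power series `c`. -/
def polyD (h : HasSimplePole G) : Polynomial ℂ →+* AddMonoid.End G :=
  Polynomial.eval₂RingHom' ((Module.toAddMonoidEnd ℂ⟦X⟧ G).comp C) (bInvA h) (fun c => by
    refine AddMonoidHom.ext fun x => ?_
    change (C c : ℂ⟦X⟧) • bInvA h x = bInvA h ((C c : ℂ⟦X⟧) • x)
    rw [bInvA_smul]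
    simp)

theorem polyD_C (h : HasSimplePole G) (c : ℂ) (x : G) :
    polyD h (Polynomial.C c) x = (C c : ℂ⟦X⟧) • x := by
  have : polyD h (Polynomial.C c) = ((Module.toAddMonoidEnd ℂ⟦X⟧ G).comp C) c :=
    Polynomial.eval₂_C _ _
  rw [this]; rfl

theorem polyD_X (h : HasSimplePole G) (x : G) : polyD h Polynomial.X x = bInvA h x := by
  have : polyD h Polynomial.X = bInvA h := Polynomial.eval₂_X _ _
  rw [this]; rfl

theorem polyD_mul (h : HasSimplePole G) (p q : Polynomial ℂ) (x : G) :
    polyD h (p * q) x = polyD h p (polyD h q x) := by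
  rw [map_mul]; rfl

theorem polyD_add (h : HasSimplePole G) (p q : Polynomial ℂ) (x : G) :
    polyD h (p + q) x = polyD h p x + polyD h q x := by
  rw [map_add]; rfl

/-- A relation between two simple pole modules which is compatible with sums, with complex scalars
and with `b⁻¹ a` is compatible with every polynomial in `b⁻¹ a`. -/
theorem polyD_rel (h : HasSimplePole G) (h' : HasSimplePole H) (R : G → H → Prop)
    (hadd : ∀ x y x' y', R x y → R x' y' → R (x + x') (y + y'))
    (hC : ∀ (c : ℂ) x y, R x y → R ((C c : ℂ⟦X⟧) • x) ((C c : ℂ⟦X⟧) • y))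
    (hD : ∀ x y, R x y → R (bInvA h x) (bInvA h' y)) (p : Polynomial ℂ) :
    ∀ x y, R x y → R (polyD h p x) (polyD h' p y) := by
  induction p using Polynomial.induction_on with
  | C c => intro x y hxy; rw [polyD_C, polyD_C]; exact hC c x y hxy
  | add p q hp hq =>
    intro x y hxy
    rw [polyD_add, polyD_add]
    exact hadd _ _ _ _ (hp x y hxy) (hq x y hxy)
  | monomial n c ih =>
    intro x y hxy
    rw [pow_succ, ← mul_assoc, polyD_mul, polyD_mul _ _ Polynomial.X, polyD_X, polyD_X]
    exact ih _ _ (hD x y hxy)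

theorem polyD_mem (h : HasSimplePole G) (N : Submodule ℂ⟦X⟧ G)
    (hD : ∀ x ∈ N, bInvA h x ∈ N) (p : Polynomial ℂ) (x : G) (hx : x ∈ N) :
    polyD h p x ∈ N :=
  polyD_rel h h (fun x _ => x ∈ N) (fun _ _ _ _ h1 h2 => N.add_mem h1 h2)
    (fun _ _ _ hx => N.smul_mem _ hx) (fun x _ hx => hD x hx) p x x hx

theorem IsABLinear.map_bInvA {f : G →ₗ[ℂ⟦X⟧] H} (hf : IsABLinear f) (h : HasSimplePole G)
    (h' : HasSimplePole H) (x : G) : f (bInvA h x) = bInvA h' (f x) := by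
  apply b_cancel
  rw [b_bInvA, ← map_smul, b_bInvA, hf]

theorem IsABLinear.map_polyD {f : G →ₗ[ℂ⟦X⟧] H} (hf : IsABLinear f) (h : HasSimplePole G)
    (h' : HasSimplePole H) (p : Polynomial ℂ) (x : G) :
    f (polyD h p x) = polyD h' p (f x) :=
  polyD_rel h h' (fun x y => f x = y) (fun _ _ _ _ h1 h2 => by rw [map_add, h1, h2])
    (fun _ _ _ hx => by rw [map_smul, hx])
    (fun x _ hx => by rw [hf.map_bInvA h h', hx]) p x _ rfl

/-- Polynomials in `b⁻¹ a` move past `bⁿ` by a translation of the variable. -/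
theorem polyD_X_pow_smul (h : HasSimplePole G) (n : ℕ) (p : Polynomial ℂ) (x : G) :
    polyD h p ((X ^ n : ℂ⟦X⟧) • x) =
      (X ^ n : ℂ⟦X⟧) • polyD h (p.comp (Polynomial.X + Polynomial.C (n : ℂ))) x := by
  induction p using Polynomial.induction_on generalizing x with
  | C c => rw [Polynomial.C_comp, polyD_C, polyD_C, smul_comm]
  | add p q hp hq => rw [Polynomial.add_comp, polyD_add, polyD_add, hp, hq, smul_add]
  | monomial m c ih =>
    rw [pow_succ, ← mul_assoc, polyD_mul, polyD_X, bInvA_X_pow_smul, ih,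
      Polynomial.mul_comp _ Polynomial.X, polyD_mul _ _ (Polynomial.X.comp _), Polynomial.X_comp,
      polyD_add, polyD_X, polyD_C]

/-- An additive map to a complex vector space which turns `b⁻¹ a` into `A` turns `p(b⁻¹ a)` into
`p(A)`. -/
theorem map_polyD_eq_aeval (h : HasSimplePole G) {W : Type*} [AddCommGroup W] [Module ℂ W]
    (A : Module.End ℂ W) (f : G →+ W) (hC : ∀ (c : ℂ) x, f ((C c : ℂ⟦X⟧) • x) = c • f x)
    (hD : ∀ x, f (bInvA h x) = A (f x)) (p : Polynomial ℂ) (x : G) :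
    f (polyD h p x) = Polynomial.aeval A p (f x) := by
  induction p using Polynomial.induction_on generalizing x with
  | C c => rw [polyD_C, hC, Polynomial.aeval_C]; rfl
  | add p q hp hq => rw [polyD_add, map_add, hp, hq, map_add]; rfl
  | monomial m c ih =>
    rw [pow_succ, ← mul_assoc, polyD_mul, polyD_X, ih, hD,
      map_mul (Polynomial.aeval A) _ Polynomial.X, Polynomial.aeval_X]
    rfl

end PolyD

/-! ### Comparing two embeddings -/

section Transfer

/-- The exponent `m` works for all elements at once because the ascending chain of the submodules
`{z | b^k z ∈ N}` is stationary. -/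
theorem exists_uniform_pow {G : Type v} [AddCommGroup G] [Module ℂ⟦X⟧ G] [Module.Finite ℂ⟦X⟧ G]
    (N : Submodule ℂ⟦X⟧ G) :
    ∃ m : ℕ, ∀ z : G, (∃ k : ℕ, (X ^ k : ℂ⟦X⟧) • z ∈ N) → (X ^ m : ℂ⟦X⟧) • z ∈ N := by
  let c : ℕ →o Submodule ℂ⟦X⟧ G :=
    ⟨fun k => N.comap (LinearMap.lsmul ℂ⟦X⟧ G (X ^ k)), fun k l hkl z hz => by
      obtain ⟨d, rfl⟩ := Nat.exists_eq_add_of_le' hkl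
      simp only [Submodule.mem_comap, LinearMap.lsmul_apply] at hz ⊢
      rw [pow_add, mul_smul]
      exact N.smul_mem _ hz⟩
  obtain ⟨m, hm⟩ := monotone_stabilizes_iff_noetherian.2 (inferInstance : IsNoetherian ℂ⟦X⟧ G) c
  refine ⟨m, fun z ⟨k, hk⟩ => ?_⟩
  have h1 : z ∈ c (max m k) := c.monotone (le_max_right m k) hk
  rw [← hm _ (le_max_left m k)] at h1
  exact h1

variable {E : Type u} [AddCommGroup E] [Module ℂ⟦X⟧ E] [ABAction E]
variable {G : Type v} [AddCommGroup G] [Module ℂ⟦X⟧ G] [ABAction G] [Module.Free ℂ⟦X⟧ G]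
variable {H : Type w} [AddCommGroup H] [Module ℂ⟦X⟧ H] [ABAction H] [Module.Free ℂ⟦X⟧ H]

theorem X_pow_succ_smul_bInvA (h : HasSimplePole G) {j : E →ₗ[ℂ⟦X⟧] G} (hj : IsABLinear j)
    {m : ℕ} {x : G} {e : E} (hx : (X ^ m : ℂ⟦X⟧) • x = j e) :
    (X ^ (m + 1) : ℂ⟦X⟧) • bInvA h x = j (ABAction.a e - (C (m : ℂ) * X : ℂ⟦X⟧) • e) := by
  rw [map_sub, hj, map_smul, ← hx, a_X_pow_smul, pow_succ, mul_smul, b_bInvA, smul_add,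
    smul_comm (C (m : ℂ) * X : ℂ⟦X⟧), add_sub_cancel_right]

/-- Let `j` and `f` embed `E` in two simple pole modules. If a polynomial in `b⁻¹ a` is divisible
by `b^K` on the image of `f`, then so it is on the image of `j`, up to a loss `b^m` which depends
on the embeddings only. Indeed the pairs `(x, y)` with `b^k (x, y) = (j e, f e)` for some `k` and
`e` are stable under `b⁻¹ a`. -/
theorem exists_transfer [Module.Finite ℂ⟦X⟧ H] (h : HasSimplePole G) (h' : HasSimplePole H)
    {j : E →ₗ[ℂ⟦X⟧] G} (hj : IsABLinear j) {f : E →ₗ[ℂ⟦X⟧] H} (hf : IsABLinear f)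
    (hinj : Function.Injective f) :
    ∃ m : ℕ, ∀ (p : Polynomial ℂ) (K : ℕ),
      (∀ x : E, ∃ z : H, polyD h' p (f x) = (X ^ K : ℂ⟦X⟧) • z) →
      ∀ x : E, ∃ e : E, (X ^ m : ℂ⟦X⟧) • polyD h p (j x) = (X ^ K : ℂ⟦X⟧) • j e := by
  obtain ⟨m, hm⟩ := exists_uniform_pow (LinearMap.range f)
  refine ⟨m, fun p K hp x => ?_⟩
  obtain ⟨k, e, h1, h2⟩ := polyD_rel h h'
    (fun x y => ∃ (k : ℕ) (e : E), (X ^ k : ℂ⟦X⟧) • x = j e ∧ (X ^ k : ℂ⟦X⟧) • y = f e)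
    (by
      rintro x y x' y' ⟨k, e, h1, h2⟩ ⟨k', e', h1', h2'⟩
      refine ⟨k + k', (X ^ k' : ℂ⟦X⟧) • e + (X ^ k : ℂ⟦X⟧) • e', ?_, ?_⟩
      · rw [map_add, map_smul, map_smul, ← h1, ← h1', smul_add, smul_smul, smul_smul, pow_add,
          mul_comm (X ^ k' : ℂ⟦X⟧)]
      · rw [map_add, map_smul, map_smul, ← h2, ← h2', smul_add, smul_smul, smul_smul, pow_add,
          mul_comm (X ^ k' : ℂ⟦X⟧)])
    (by
      rintro c x y ⟨k, e, h1, h2⟩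
      refine ⟨k, (C c : ℂ⟦X⟧) • e, ?_, ?_⟩
      · rw [smul_comm, h1, map_smul]
      · rw [smul_comm, h2, map_smul])
    (by
      rintro x y ⟨k, e, h1, h2⟩
      exact ⟨k + 1, _, X_pow_succ_smul_bInvA h hj h1, X_pow_succ_smul_bInvA h' hf h2⟩)
    p (j x) (f x) ⟨0, x, by simp, by simp⟩
  obtain ⟨z, hz⟩ := hp x
  rw [hz, smul_smul, ← pow_add] at h2
  obtain ⟨e', he'⟩ := hm z ⟨k + K, e, h2.symm⟩
  refine ⟨e', ?_⟩
  have h3 : (X ^ m : ℂ⟦X⟧) • e = (X ^ (k + K) : ℂ⟦X⟧) • e' := by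
    apply hinj
    rw [map_smul, map_smul, ← h2, he', smul_comm]
  apply smul_X_pow_cancel (n := k)
  rw [smul_comm, h1, ← map_smul, h3, map_smul, pow_add, mul_smul]

end Transfer

/-! ### The Jordan block acting on the coefficients of asymptotic expansions -/

section Jordan

/-- The nilpotent operator `(v_j) ↦ ((j + 1) v_{j+1})`: the derivative in `log s` of
`∑ v_j (log s)^j`. -/
def logDeriv (N : ℕ) : Module.End ℂ (Fin (N + 1) → ℂ) where
  toFun v j := if h : (j : ℕ) + 1 < N + 1 then ((j : ℂ) + 1) * v ⟨j + 1, h⟩ else 0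
  map_add' v w := by
    funext j
    simp only [Pi.add_apply]
    split_ifs
    · ring
    · simp
  map_smul' c v := by
    funext j
    simp only [Pi.smul_apply, smul_eq_mul, RingHom.id_apply]
    split_ifs
    · ring
    · simp

theorem logDeriv_apply (N : ℕ) (v : Fin (N + 1) → ℂ) (j : Fin (N + 1)) :
    logDeriv N v j = if h : (j : ℕ) + 1 < N + 1 then ((j : ℂ) + 1) * v ⟨j + 1, h⟩ else 0 := rfl

theorem logDeriv_pow_apply_eq_zero (N k : ℕ) (v : Fin (N + 1) → ℂ) (j : Fin (N + 1))
    (h : N + 1 ≤ j + k) : (logDeriv N ^ k) v j = 0 := by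
  induction k generalizing j with
  | zero => exact absurd j.2 (by omega)
  | succ k ih =>
    rw [pow_succ', Module.End.mul_apply, logDeriv_apply]
    split_ifs with h'
    · rw [ih ⟨j + 1, h'⟩ (by simp only; omega), mul_zero]
    · rfl

theorem logDeriv_pow_eq_zero (N : ℕ) : logDeriv N ^ (N + 1) = 0 :=
  LinearMap.ext fun v => funext fun j => logDeriv_pow_apply_eq_zero N _ v j (by omega)

theorem eq_zero_of_logDeriv_eq_zero {N : ℕ} {v : Fin (N + 1) → ℂ} (hv : logDeriv N v = 0)
    (j : Fin (N + 1)) (hj : j ≠ 0) : v j = 0 := by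
  obtain ⟨i, hi⟩ : ∃ i : ℕ, (j : ℕ) = i + 1 :=
    Nat.exists_eq_succ_of_ne_zero fun h => hj (Fin.ext h)
  have hiN : i + 1 < N + 1 := hi ▸ j.2
  have h := congrFun hv ⟨i, by omega⟩
  rw [logDeriv_apply, dif_pos hiN] at h
  have hj' : j = ⟨i + 1, hiN⟩ := Fin.ext hi
  rw [hj']
  exact (mul_eq_zero.1 h).resolve_left (Nat.cast_add_one_ne_zero i)

/-- The Jordan block with eigenvalue `r`, through which `b⁻¹ a` acts on the coefficients
of `s^{r-1} (log s)^j`. -/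
def jordan (N : ℕ) (r : ℂ) : Module.End ℂ (Fin (N + 1) → ℂ) :=
  algebraMap ℂ _ r + logDeriv N

theorem jordan_apply (N : ℕ) (r : ℂ) (v : Fin (N + 1) → ℂ) :
    jordan N r v = r • v + logDeriv N v := rfl

theorem aeval_jordan_X_sub_C (N : ℕ) (r : ℂ) :
    Polynomial.aeval (jordan N r) (Polynomial.X - Polynomial.C r) = logDeriv N := by
  rw [map_sub, Polynomial.aeval_X, Polynomial.aeval_C, jordan, add_sub_cancel_left]

theorem aeval_jordan_X_sub_C_pow (N : ℕ) (r : ℂ) :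
    Polynomial.aeval (jordan N r) ((Polynomial.X - Polynomial.C r) ^ (N + 1)) = 0 := by
  rw [map_pow, aeval_jordan_X_sub_C, logDeriv_pow_eq_zero]

theorem aeval_jordan_eq_zero_of_dvd {N : ℕ} {r : ℂ} {p : Polynomial ℂ}
    (h : (Polynomial.X - Polynomial.C r) ^ (N + 1) ∣ p) :
    Polynomial.aeval (jordan N r) p = 0 := by
  obtain ⟨q, rfl⟩ := h
  rw [map_mul, aeval_jordan_X_sub_C_pow, zero_mul]

/-- A polynomial which does not vanish at the eigenvalue is invertible on the Jordan block. -/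
theorem eq_zero_of_aeval_jordan_eq_zero {N : ℕ} {r : ℂ} {p : Polynomial ℂ} (hp : p.eval r ≠ 0)
    {v : Fin (N + 1) → ℂ} (hv : Polynomial.aeval (jordan N r) p v = 0) : v = 0 := by
  have hco : IsCoprime p ((Polynomial.X - Polynomial.C r) ^ (N + 1)) := by
    refine IsCoprime.pow_right (IsCoprime.symm ?_)
    rw [(Polynomial.irreducible_X_sub_C r).coprime_iff_not_dvd, Polynomial.dvd_iff_isRoot]
    exact hp
  obtain ⟨u, w, huw⟩ := hco
  have h := congrArg (fun q => Polynomial.aeval (jordan N r) q v) huw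
  simp only [map_add, map_mul, aeval_jordan_X_sub_C_pow, mul_zero, add_zero, map_one,
    Module.End.mul_apply, hv, map_zero, Module.End.one_apply] at h
  exact h.symm

/-- A polynomial with simple roots only kills vectors without logarithm. -/
theorem logDeriv_eq_zero_of_aeval_prod_eq_zero {N : ℕ} {r : ℂ} (S : Finset ℂ)
    {v : Fin (N + 1) → ℂ}
    (hv : Polynomial.aeval (jordan N r) (∏ c ∈ S, (Polynomial.X - Polynomial.C c)) v = 0) :
    logDeriv N v = 0 := by
  classical
  have hne : ∀ s : Finset ℂ, r ∉ s →
      (∏ c ∈ s, (Polynomial.X - Polynomial.C c) : Polynomial ℂ).eval r ≠ 0 := fun s hs => by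
    rw [Polynomial.eval_prod, Finset.prod_ne_zero_iff]
    intro c hc h0
    rw [Polynomial.eval_sub, Polynomial.eval_X, Polynomial.eval_C, sub_eq_zero] at h0
    exact hs (h0 ▸ hc)
  by_cases hr : r ∈ S
  · rw [← Finset.prod_erase_mul S _ hr, map_mul, aeval_jordan_X_sub_C] at hv
    exact eq_zero_of_aeval_jordan_eq_zero (hne _ (Finset.notMem_erase r S)) hv
  · rw [eq_zero_of_aeval_jordan_eq_zero (hne S hr) hv, map_zero]

end Jordan

/-! ### Coefficients in the module of asymptotic expansions -/

section Expansions

instance (l : ℚ) (N : ℕ) : Module.Free ℂ⟦X⟧ (Xi l N) :=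
  inferInstanceAs (Module.Free ℂ⟦X⟧ (Fin (N + 1) → ℂ⟦X⟧))

instance (l : ℚ) (N : ℕ) : Module.Finite ℂ⟦X⟧ (Xi l N) :=
  inferInstanceAs (Module.Finite ℂ⟦X⟧ (Fin (N + 1) → ℂ⟦X⟧))

variable {Λ : Finset ℚ} {N p : ℕ}

theorem XiSum.a_apply (x : XiSum Λ N p) (q : Fin p) (l : Λ) (j : Fin (N + 1)) :
    (ABAction.a x : XiSum Λ N p) q l j =
      X * (C ((l : ℚ) : ℂ) * (x q l).coef j + C ((j : ℂ) + 1) * (x q l).coef (j + 1))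
        + X ^ 2 * derivative ℂ ((x q l).coef j) := rfl

theorem Xi.coef_fin {l : ℚ} {N : ℕ} (f : Xi l N) (j : Fin (N + 1)) : f.coef j = f j :=
  dif_pos j.2

theorem XiSum.hasSimplePole (Λ : Finset ℚ) (N p : ℕ) : HasSimplePole (XiSum Λ N p) := fun x =>
  ⟨fun q l => (fun j : Fin (N + 1) =>
      (C ((l : ℚ) : ℂ) * (x q l).coef j + C ((j : ℂ) + 1) * (x q l).coef (j + 1))
        + X * derivative ℂ ((x q l).coef j) : Fin (N + 1) → ℂ⟦X⟧), by
    funext q l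
    funext j
    rw [XiSum.a_apply]
    change _ = X * ((C ((l : ℚ) : ℂ) * (x q l).coef j + C ((j : ℂ) + 1) * (x q l).coef (j + 1))
        + X * derivative ℂ ((x q l).coef j))
    ring⟩

/-- The coefficients of `bⁿ s^{l-1} (log s)^j`, `j ≤ N`, in the component of index `(q, l)`. -/
def XiSum.comp (q : Fin p) (l : Λ) (n : ℕ) : XiSum Λ N p →+ (Fin (N + 1) → ℂ) where
  toFun x j := coeff n (x q l j)
  map_zero' := funext fun _ => map_zero (coeff (R := ℂ) n)
  map_add' x y := funext fun j => map_add (coeff (R := ℂ) n) (x q l j) (y q l j)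

theorem XiSum.comp_apply (q : Fin p) (l : Λ) (n : ℕ) (x : XiSum Λ N p) (j : Fin (N + 1)) :
    XiSum.comp q l n x j = coeff n (x q l j) := rfl

theorem XiSum.smul_apply (S : ℂ⟦X⟧) (x : XiSum Λ N p) (q : Fin p) (l : Λ) (j : Fin (N + 1)) :
    (S • x) q l j = S * x q l j := rfl

theorem XiSum.comp_C_smul (q : Fin p) (l : Λ) (n : ℕ) (c : ℂ) (x : XiSum Λ N p) :
    XiSum.comp q l n ((C c : ℂ⟦X⟧) • x) = c • XiSum.comp q l n x := by
  funext j
  rw [XiSum.comp_apply, XiSum.smul_apply, coeff_C_mul]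
  rfl

theorem XiSum.comp_X_pow_smul (q : Fin p) (l : Λ) (n K : ℕ) (x : XiSum Λ N p) :
    XiSum.comp q l (n + K) ((X ^ K : ℂ⟦X⟧) • x) = XiSum.comp q l n x := by
  funext j
  rw [XiSum.comp_apply, XiSum.smul_apply, coeff_X_pow_mul]
  rfl

theorem XiSum.comp_X_pow_smul_of_lt (q : Fin p) (l : Λ) {n K : ℕ} (h : n < K)
    (x : XiSum Λ N p) : XiSum.comp q l n ((X ^ K : ℂ⟦X⟧) • x) = 0 := by
  funext j
  rw [XiSum.comp_apply, XiSum.smul_apply, coeff_X_pow_mul', if_neg (by omega)]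
  rfl

theorem XiSum.exists_X_pow_smul {x : XiSum Λ N p} {K : ℕ}
    (h : ∀ q l n, n < K → XiSum.comp q l n x = 0) :
    ∃ y : XiSum Λ N p, x = (X ^ K : ℂ⟦X⟧) • y := by
  have h' : ∀ q l j, (X ^ K : ℂ⟦X⟧) ∣ x q l j := fun q l j =>
    X_pow_dvd_iff.2 fun n hn => congrFun (h q l n hn) j
  choose y hy using h'
  exact ⟨fun q l => (fun j => y q l j : Fin (N + 1) → ℂ⟦X⟧), by
    funext q l
    funext j
    exact hy q l j⟩

theorem XiSum.comp_bInvA (q : Fin p) (l : Λ) (n : ℕ) (x : XiSum Λ N p) :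
    XiSum.comp q l n (bInvA (XiSum.hasSimplePole Λ N p) x) =
      jordan N (((l : ℚ) : ℂ) + n) (XiSum.comp q l n x) := by
  have h := congrArg (XiSum.comp q l (n + 1)) (b_bInvA (XiSum.hasSimplePole Λ N p) x)
  rw [← pow_one (X : ℂ⟦X⟧), XiSum.comp_X_pow_smul] at h
  rw [h]
  funext j
  rw [XiSum.comp_apply, XiSum.a_apply, jordan_apply, Pi.add_apply, logDeriv_apply,
    Pi.smul_apply, smul_eq_mul, XiSum.comp_apply, Xi.coef_fin, pow_two, mul_assoc X X, ← mul_add,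
    coeff_succ_X_mul, map_add, map_add, coeff_C_mul, coeff_C_mul]
  rw [coeff_X_mul_derivative]
  unfold Xi.coef
  split_ifs
  · rw [XiSum.comp_apply]; ring
  · rw [map_zero]; ring

theorem XiSum.comp_polyD (q : Fin p) (l : Λ) (n : ℕ) (P : Polynomial ℂ) (x : XiSum Λ N p) :
    XiSum.comp q l n (polyD (XiSum.hasSimplePole Λ N p) P x) =
      Polynomial.aeval (jordan N (((l : ℚ) : ℂ) + n)) P (XiSum.comp q l n x) :=
  map_polyD_eq_aeval _ _ (XiSum.comp q l n) (XiSum.comp_C_smul q l n) (XiSum.comp_bInvA q l n) P x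

end Expansions

/-! ### Regular modules of rank one and semi-simple modules -/

section Semisimple

/-- A nonzero element of a free module is `bⁿ` times an element which is not divisible by `b`. -/
theorem exists_X_pow_smul_of_ne_zero {G : Type*} [AddCommGroup G] [Module ℂ⟦X⟧ G]
    [Module.Free ℂ⟦X⟧ G] {x : G} (hx : x ≠ 0) :
    ∃ (n : ℕ) (y : G), x = (X ^ n : ℂ⟦X⟧) • y ∧ ¬ ∃ z, y = (X : ℂ⟦X⟧) • z := by
  by_contra! hcon
  have hall : ∀ n : ℕ, ∃ y : G, x = (X ^ n : ℂ⟦X⟧) • y := fun n => by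
    induction n with
    | zero => exact ⟨x, by simp⟩
    | succ n ih =>
      obtain ⟨y, hy⟩ := ih
      obtain ⟨z, hz⟩ := hcon n y hy
      exact ⟨z, by rw [hy, hz, smul_smul, pow_succ]⟩
  apply hx
  let B := Module.Free.chooseBasis ℂ⟦X⟧ G
  apply B.repr.injective
  rw [map_zero]
  ext i n
  obtain ⟨y, hy⟩ := hall (n + 1)
  rw [hy, map_smul, Finsupp.smul_apply, smul_eq_mul, coeff_X_pow_mul', if_neg (by omega)]
  simp

/-- A regular module of rank one has a simple pole, and `b⁻¹ a` acts as a scalar on `G / b G`. -/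
theorem exists_scalar_of_rank_one (G : ABMod) (hG : IsRegular G.carrier)
    (h1 : Module.finrank ℂ⟦X⟧ G.carrier = 1) :
    ∃ (h : HasSimplePole G.carrier) (c : ℂ), ∀ x, ∃ y,
      bInvA h x = (C c : ℂ⟦X⟧) • x + (X : ℂ⟦X⟧) • y := by
  obtain ⟨H, i, hH, hi, hinj⟩ := hG
  let B := Module.finBasisOfFinrankEq ℂ⟦X⟧ G.carrier h1
  have hgen : ∀ x, ∃ S : ℂ⟦X⟧, x = S • B 0 := fun x => ⟨B.repr x 0, by
    conv_lhs => rw [← B.sum_repr x]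
    simp⟩
  obtain ⟨S, hS⟩ := hgen (ABAction.a (B 0))
  have hie : i (B 0) ≠ 0 := fun h0 => B.ne_zero 0 (hinj (by rw [h0, map_zero]))
  obtain ⟨n, y, hy, hny⟩ := exists_X_pow_smul_of_ne_zero hie
  -- `S` is not a unit, for otherwise `y` would be divisible by `b`.
  have hSX : (X : ℂ⟦X⟧) ∣ S := by
    rw [X_dvd_iff]
    by_contra hS0
    obtain ⟨w, hw⟩ := hH y
    have h2 : S • y = (X : ℂ⟦X⟧) • (w + (C (n : ℂ) : ℂ⟦X⟧) • y) := by
      apply smul_X_pow_cancel (n := n)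
      rw [smul_comm, ← hy, ← map_smul, ← hS, hi, hy, a_X_pow_smul, hw, smul_add X, smul_smul X,
        mul_comm X]
    obtain ⟨u, hu⟩ := isUnit_iff_constantCoeff.2 (isUnit_iff_ne_zero.2 hS0)
    refine hny ⟨(↑u⁻¹ : ℂ⟦X⟧) • (w + (C (n : ℂ) : ℂ⟦X⟧) • y), ?_⟩
    rw [smul_comm, ← h2, ← hu, smul_smul, Units.inv_mul, one_smul]
  obtain ⟨T, rfl⟩ := hSX
  have h : HasSimplePole G.carrier := fun x => by
    obtain ⟨U, rfl⟩ := hgen x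
    refine ⟨(U * T + X * derivative ℂ U) • B 0, ?_⟩
    rw [ABAction.a_smul, hS, smul_smul, smul_smul, ← add_smul]
    congr 1
    ring
  obtain ⟨T', hT'⟩ : (X : ℂ⟦X⟧) ∣ T - C (constantCoeff T) := by
    rw [X_dvd_iff]; simp
  refine ⟨h, constantCoeff T, fun x => ?_⟩
  obtain ⟨U, rfl⟩ := hgen x
  have hDe : bInvA h (B 0) = T • B 0 := by
    apply b_cancel
    rw [b_bInvA, hS, smul_smul]
  refine ⟨(U * T' + derivative ℂ U) • B 0, ?_⟩
  rw [bInvA_smul, hDe, smul_smul, smul_smul, smul_smul, ← add_smul, ← add_smul]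
  congr 1
  linear_combination U * hT'

/-- If `b⁻¹ a` is the scalar `c` modulo `b`, it is the scalar `c + n` on `bⁿ G / bⁿ⁺¹ G`. -/
theorem exists_polyD_prod_eq {G : Type*} [AddCommGroup G] [Module ℂ⟦X⟧ G] [ABAction G]
    [Module.Free ℂ⟦X⟧ G] (h : HasSimplePole G) {c : ℂ}
    (hc : ∀ x, ∃ y, bInvA h x = (C c : ℂ⟦X⟧) • x + (X : ℂ⟦X⟧) • y) (K : ℕ) (x : G) :
    ∃ z, polyD h (∏ n ∈ Finset.range K, (Polynomial.X - Polynomial.C (c + n))) x =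
      (X ^ K : ℂ⟦X⟧) • z := by
  induction K with
  | zero => exact ⟨x, by simp⟩
  | succ K ih =>
    obtain ⟨z, hz⟩ := ih
    obtain ⟨y, hy⟩ := hc z
    refine ⟨y, ?_⟩
    rw [Finset.prod_range_succ, mul_comm, polyD_mul, hz, polyD_X_pow_smul, pow_succ, mul_smul]
    congr 1
    have : (Polynomial.X - Polynomial.C (c + K)).comp (Polynomial.X + Polynomial.C (K : ℂ)) =
        Polynomial.X + Polynomial.C (-c) := by
      rw [Polynomial.sub_comp, Polynomial.X_comp, Polynomial.C_comp, map_add, map_neg]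
      ring
    rw [this, polyD_add, polyD_X, polyD_C, hy, map_neg, neg_smul]
    abel

theorem IsABLinear.compose {E : Type*} [AddCommGroup E] [Module ℂ⟦X⟧ E] [ABAction E]
    {F : Type*} [AddCommGroup F] [Module ℂ⟦X⟧ F] [ABAction F]
    {G : Type*} [AddCommGroup G] [Module ℂ⟦X⟧ G] [ABAction G]
    {g : F →ₗ[ℂ⟦X⟧] G} (hg : IsABLinear g) {f : E →ₗ[ℂ⟦X⟧] F} (hf : IsABLinear f) :
    IsABLinear (g.comp f) := fun x => by
  rw [LinearMap.comp_apply, LinearMap.comp_apply, hf, hg]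

theorem isABLinear_subtype {E : Type*} [AddCommGroup E] [Module ℂ⟦X⟧ E] [ABAction E]
    (F : ABSubmodule E) : IsABLinear F.toSubmodule.subtype := fun _ => rfl

theorem IsSemiSimple.of_injective {E : Type*} [AddCommGroup E] [Module ℂ⟦X⟧ E] [ABAction E]
    {F : Type*} [AddCommGroup F] [Module ℂ⟦X⟧ F] [ABAction F] (hE : IsSemiSimple E)
    {g : F →ₗ[ℂ⟦X⟧] E} (hg : IsABLinear g) (hinj : Function.Injective g) : IsSemiSimple F := by
  obtain ⟨n, G, f, hG, hf, hfi⟩ := hE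
  exact ⟨n, G, f.comp g, hG, hf.compose hg, hfi.comp hinj⟩

/-- The elements of a semi-simple module have asymptotic expansions without logarithms, whatever
the embedding in a module of expansions: modulo each power of `b`, a polynomial in `b⁻¹ a` with
simple roots vanishes on a sum of regular modules of rank one. -/
theorem IsSemiSimple.logDeriv_comp_eq_zero {E : Type*} [AddCommGroup E] [Module ℂ⟦X⟧ E]
    [ABAction E] (hE : IsSemiSimple E) {Λ : Finset ℚ} {N p : ℕ} {j : E →ₗ[ℂ⟦X⟧] XiSum Λ N p}
    (hj : IsABLinear j) (x : E) (q : Fin p) (l : Λ) (n : ℕ) :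
    logDeriv N (XiSum.comp q l n (j x)) = 0 := by
  classical
  obtain ⟨k, G, f, hG, hf, hfi⟩ := hE
  choose h c hc using fun i => exists_scalar_of_rank_one (G i) (hG i).1 (hG i).2
  have hpi : HasSimplePole (∀ i, (G i).carrier) := fun y =>
    ⟨fun i => bInvA (h i) (y i), funext fun i => (b_bInvA (h i) (y i)).symm⟩
  obtain ⟨m, hm⟩ := exists_transfer (XiSum.hasSimplePole Λ N p) hpi hj hf hfi
  set K := m + (n + 1) with hK
  let S : Finset ℂ := Finset.univ.biUnion fun i : Fin k =>
    (Finset.range K).image fun r : ℕ => c i + r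
  obtain ⟨e, he⟩ := hm (∏ r ∈ S, (Polynomial.X - Polynomial.C r)) K (fun x => by
    have : ∀ i, ∃ z, polyD (h i) (∏ r ∈ S, (Polynomial.X - Polynomial.C r)) (f x i) =
        (X ^ K : ℂ⟦X⟧) • z := fun i => by
      have hsub : (Finset.range K).image (fun r : ℕ => c i + r) ⊆ S :=
        Finset.subset_biUnion_of_mem (fun i : Fin k =>
          (Finset.range K).image fun r : ℕ => c i + r) (Finset.mem_univ i)
      rw [← Finset.prod_sdiff hsub, mul_comm, polyD_mul, Finset.prod_image (fun a _ b _ hab => by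
        simpa using hab)]
      exact exists_polyD_prod_eq (h i) (hc i) K _
    choose z hz using this
    refine ⟨z, funext fun i => ?_⟩
    have hproj : IsABLinear (LinearMap.proj i : (∀ i, (G i).carrier) →ₗ[ℂ⟦X⟧] (G i).carrier) :=
      fun _ => rfl
    exact (hproj.map_polyD hpi (h i) _ (f x)).trans (hz i)) x
  apply logDeriv_eq_zero_of_aeval_prod_eq_zero (r := ((l : ℚ) : ℂ) + n) S
  rw [← XiSum.comp_polyD, ← XiSum.comp_X_pow_smul q l n m, he,
    XiSum.comp_X_pow_smul_of_lt q l (by omega)]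

theorem rankOneA_apply (c : ℂ) (S : ℂ⟦X⟧) :
    rankOneA c S = C c * X * S + X ^ 2 * derivative ℂ S := rfl

theorem exists_rankOneA_eq_X_mul (c : ℂ) (S : ℂ⟦X⟧) : ∃ T, rankOneA c S = X * T :=
  ⟨C c * S + X * derivative ℂ S, by rw [rankOneA_apply]; ring⟩

theorem rankOne_hasSimplePole (c : ℂ) : HasSimplePole (RankOne c) :=
  exists_rankOneA_eq_X_mul c

/-- Criterion of semi-simplicity in terms of functionals with values in the modules `E_c`. -/
theorem isSemiSimple_of_functionals {E : Type*} [AddCommGroup E] [Module ℂ⟦X⟧ E] [ABAction E]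
    {ι : Type*} [Fintype ι] (c : ι → ℂ) (g : ι → E →ₗ[ℂ⟦X⟧] ℂ⟦X⟧)
    (hg : ∀ i x, g i (ABAction.a x) = rankOneA (c i) (g i x))
    (hinj : ∀ x, (∀ i, g i x = 0) → x = 0) : IsSemiSimple E := by
  have hfree : ∀ c, Module.Free ℂ⟦X⟧ (RankOne c) := fun _ =>
    inferInstanceAs (Module.Free ℂ⟦X⟧ ℂ⟦X⟧)
  have hfin : ∀ c, Module.Finite ℂ⟦X⟧ (RankOne c) := fun _ =>
    inferInstanceAs (Module.Finite ℂ⟦X⟧ ℂ⟦X⟧)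
  let s := (Fintype.equivFin ι).symm
  let f : E →ₗ[ℂ⟦X⟧] (∀ i : Fin (Fintype.card ι), RankOne (c (s i))) :=
    LinearMap.pi fun i => (g (s i) : E →ₗ[ℂ⟦X⟧] ℂ⟦X⟧)
  refine ⟨Fintype.card ι, fun i => ⟨RankOne (c (s i))⟩, f, fun i => ⟨?_, ?_⟩, fun x => ?_, ?_⟩
  · refine ⟨⟨RankOne (c (s i))⟩, LinearMap.id, rankOne_hasSimplePole _,
      fun _ => rfl, fun _ _ h => h⟩
  · exact Module.finrank_self ℂ⟦X⟧
  · exact funext fun i => hg (s i) x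
  · rw [← LinearMap.ker_eq_bot, LinearMap.ker_eq_bot']
    intro x hx
    apply hinj
    intro i
    obtain ⟨i, rfl⟩ := s.surjective i
    exact congrFun hx i

end Semisimple

/-! ### Primitive modules of asymptotic expansions -/

section Primitive

variable {F : Type u} [AddCommGroup F] [Module ℂ⟦X⟧ F] [ABAction F]

theorem Fiber.mk_eq_zero_iff {G : Type v} [AddCommGroup G] [Module ℂ⟦X⟧ G] (x : G) :
    Fiber.mk G x = 0 ↔ ∃ y, x = (X : ℂ⟦X⟧) • y := by
  refine (Submodule.Quotient.mk_eq_zero (bImage ⊤ : Submodule ℂ⟦X⟧ G)).trans ?_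
  constructor
  · rintro ⟨y, -, rfl⟩
    exact ⟨y, rfl⟩
  · rintro ⟨y, rfl⟩
    exact ⟨y, trivial, rfl⟩

theorem Fiber.mk_polyD {G : Type v} [AddCommGroup G] [Module ℂ⟦X⟧ G] [ABAction G]
    [Module.Free ℂ⟦X⟧ G] (h : HasSimplePole G) (P : Polynomial ℂ) (x : G) :
    Fiber.mk G (polyD h P x) =
      Polynomial.aeval (negBInvA h) (P.comp (-Polynomial.X)) (Fiber.mk G x) := by
  rw [Polynomial.aeval_comp, map_neg, Polynomial.aeval_X]
  refine map_polyD_eq_aeval h (-negBInvA h) (Fiber.mk G).toAddMonoidHom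
    (fun c x => map_smul (Fiber.mk G) (C c) x) (fun x => ?_) P x
  change Fiber.mk G (bInvA h x) = - Fiber.mk G (-bInvA h x)
  rw [map_neg, neg_neg]

theorem bernsteinOfSimplePole_dvd {G : Type v} [AddCommGroup G] [Module ℂ⟦X⟧ G] [ABAction G]
    [Module.Free ℂ⟦X⟧ G] (h : HasSimplePole G) (P : Polynomial ℂ)
    (hP : ∀ x, ∃ y, polyD h P x = (X : ℂ⟦X⟧) • y) :
    bernsteinOfSimplePole h ∣ P.comp (-Polynomial.X) := by
  refine minpoly.dvd _ _ (LinearMap.ext fun x => ?_)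
  obtain ⟨x, rfl⟩ : ∃ y, Fiber.mk G y = x := Submodule.Quotient.mk_surjective _ x
  rw [← Fiber.mk_polyD, (Fiber.mk_eq_zero_iff _).2 (hP x)]
  rfl

theorem polyD_bernsteinOfSimplePole {G : Type v} [AddCommGroup G] [Module ℂ⟦X⟧ G] [ABAction G]
    [Module.Free ℂ⟦X⟧ G] (h : HasSimplePole G) (x : G) :
    ∃ y, polyD h ((bernsteinOfSimplePole h).comp (-Polynomial.X)) x = (X : ℂ⟦X⟧) • y := by
  rw [← Fiber.mk_eq_zero_iff, Fiber.mk_polyD, Polynomial.comp_assoc]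
  simp only [Polynomial.neg_comp, Polynomial.X_comp, neg_neg, Polynomial.comp_X]
  rw [bernsteinOfSimplePole, minpoly.aeval]
  rfl

/-- By minimality, a module has finite colength in its saturation. -/
theorem IsSaturation.exists_pow {G : ABMod} {i : F →ₗ[ℂ⟦X⟧] G.carrier}
    (hi : IsSaturation G i) : ∃ m : ℕ, ∀ g : G.carrier, ∃ x, (X ^ m : ℂ⟦X⟧) • g = i x := by
  obtain ⟨h, hlin, -, hmin⟩ := hi
  obtain ⟨m, hm⟩ := exists_uniform_pow (LinearMap.range i)
  have hD : ∀ g, (∃ x, (X ^ m : ℂ⟦X⟧) • g = i x) →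
      ∃ x, (X ^ m : ℂ⟦X⟧) • bInvA h g = i x := fun g ⟨x, hx⟩ => by
    obtain ⟨y, hy⟩ := hm (bInvA h g) ⟨m + 1, _, (X_pow_succ_smul_bInvA h hlin hx).symm⟩
    exact ⟨y, hy.symm⟩
  let H : ABSubmodule G.carrier :=
    { toSubmodule := (LinearMap.range i).comap (LinearMap.lsmul ℂ⟦X⟧ G.carrier (X ^ m))
      a_mem := fun g ⟨x, hx⟩ => by
        obtain ⟨y, hy⟩ := hD g ⟨x, hx.symm⟩
        refine ⟨(X : ℂ⟦X⟧) • y, ?_⟩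
        rw [map_smul, ← hy, ← b_bInvA h g, LinearMap.lsmul_apply, smul_comm] }
  have htop : H.toSubmodule = ⊤ := by
    refine hmin H ?_ ?_
    · rintro _ ⟨x, rfl⟩
      exact ⟨(X ^ m : ℂ⟦X⟧) • x, map_smul i _ x⟩
    · rintro ⟨g, x, hx⟩
      obtain ⟨y, hy⟩ := hD g ⟨x, hx.symm⟩
      exact ⟨⟨bInvA h g, y, hy.symm⟩, Subtype.ext (b_bInvA h g).symm⟩
  refine ⟨m, fun g => ?_⟩
  obtain ⟨x, hx⟩ : g ∈ H.toSubmodule := htop ▸ Submodule.mem_top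
  exact ⟨x, hx.symm⟩

variable {Λ : Finset ℚ} {N p : ℕ}

theorem isRegular_of_embedding {j : F →ₗ[ℂ⟦X⟧] XiSum Λ N p} (hj : IsABLinear j)
    (hinj : Function.Injective j) : IsRegular F :=
  ⟨⟨XiSum Λ N p⟩, j, XiSum.hasSimplePole Λ N p, hj, hinj⟩

/-- A module of expansions in which only the exponents `l - 1 + ℕ` occur is `[l]`-primitive:
modulo `b^K` it is killed by `∏ (b⁻¹ a - l - n)^{N+1}`, `n < K`. -/
theorem isPrimitive_of_component {j : F →ₗ[ℂ⟦X⟧] XiSum Λ N p} (hj : IsABLinear j)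
    (hinj : Function.Injective j) (l : ℚ)
    (hl : ∀ x q (l' : Λ), (l' : ℚ) ≠ l → j x q l' = 0) : IsPrimitive F {l} := by
  refine ⟨isRegular_of_embedding hj hinj, ?_⟩
  rintro _ ⟨G, i, h, hi, rfl⟩ r hr
  obtain ⟨m', hm'⟩ := hi.exists_pow
  obtain ⟨m, hm⟩ := exists_transfer h (XiSum.hasSimplePole Λ N p) hi.2.1 hj hinj
  set K := m + (m' + 1) with hK
  set P : Polynomial ℂ :=
    ∏ n ∈ Finset.range K, (Polynomial.X - Polynomial.C ((l : ℂ) + n)) ^ (N + 1) with hP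
  have h1 := hm P K (fun x => XiSum.exists_X_pow_smul fun q l' n hn => by
    rw [XiSum.comp_polyD]
    by_cases hll : (l' : ℚ) = l
    · rw [aeval_jordan_eq_zero_of_dvd]
      · rfl
      · rw [hll]
        exact Finset.dvd_prod_of_mem
          (fun n : ℕ => (Polynomial.X - Polynomial.C ((l : ℂ) + n)) ^ (N + 1))
          (Finset.mem_range.2 hn)
    · have : XiSum.comp q l' n (j x) = 0 := by
        funext k
        rw [XiSum.comp_apply, hl x q l' hll]
        exact map_zero _
      rw [this, map_zero])
  have h2 := bernsteinOfSimplePole_dvd h (P.comp (Polynomial.X + Polynomial.C (m' : ℂ)))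
    (fun g => by
      obtain ⟨x, hx⟩ := hm' g
      obtain ⟨e, he⟩ := h1 x
      refine ⟨i e, smul_X_pow_cancel (n := m + m') ?_⟩
      rw [← hx, polyD_X_pow_smul, smul_smul, ← pow_add] at he
      rw [he, smul_smul, ← pow_succ, hK, add_assoc])
  have h3 : P.eval (-r + m') = 0 := by
    have := hr.dvd h2
    rw [Polynomial.IsRoot, Polynomial.eval_comp, Polynomial.eval_comp] at this
    simpa using this
  rw [hP, Polynomial.eval_prod, Finset.prod_eq_zero_iff] at h3
  obtain ⟨n, -, hn⟩ := h3
  rw [Polynomial.eval_pow, Polynomial.eval_sub, Polynomial.eval_X, Polynomial.eval_C] at hn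
  refine ⟨l, rfl, (m' : ℤ) - n, ?_⟩
  push_cast
  linear_combination -(eq_zero_of_pow_eq_zero hn)

/-- The saturation inside a module of expansions: the smallest submodule which contains the given
one and is stable under `b⁻¹ a`. -/
theorem exists_isSaturation {j : F →ₗ[ℂ⟦X⟧] XiSum Λ N p} (hj : IsABLinear j)
    (hinj : Function.Injective j) :
    ∃ (G : ABMod) (i : F →ₗ[ℂ⟦X⟧] G.carrier), IsSaturation G i := by
  let D := bInvA (XiSum.hasSimplePole Λ N p)
  let T : Set (Submodule ℂ⟦X⟧ (XiSum Λ N p)) := {H | LinearMap.range j ≤ H ∧ ∀ x ∈ H, D x ∈ H}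
  have hD : ∀ x ∈ sInf T, D x ∈ sInf T := fun x hx => by
    rw [Submodule.mem_sInf] at hx ⊢
    exact fun H hH => hH.2 x (hx H hH)
  have hle : LinearMap.range j ≤ sInf T := le_sInf fun H hH => hH.1
  obtain ⟨H, hH⟩ : ∃ H : ABSubmodule (XiSum Λ N p), H.toSubmodule = sInf T :=
    ⟨{ toSubmodule := sInf T
       a_mem := fun x hx => by
         rw [← b_bInvA (XiSum.hasSimplePole Λ N p)]
         exact Submodule.smul_mem _ _ (hD x hx) }, rfl⟩
  rw [← hH] at hD hle
  refine ⟨⟨H.toSubmodule⟩, j.codRestrict H.toSubmodule fun x => hle ⟨x, rfl⟩, ?_, ?_, ?_, ?_⟩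
  · rintro ⟨x, hx⟩
    exact ⟨⟨D x, hD x hx⟩, Subtype.ext (b_bInvA (XiSum.hasSimplePole Λ N p) x).symm⟩
  · exact fun x => Subtype.ext (hj x)
  · exact fun x y hxy => hinj (Subtype.ext_iff.1 hxy)
  · intro K hK hKs
    have hmem : K.toSubmodule.map H.toSubmodule.subtype ∈ T := by
      refine ⟨?_, ?_⟩
      · rintro _ ⟨x, rfl⟩
        exact ⟨_, hK ⟨x, rfl⟩, rfl⟩
      · rintro _ ⟨y, hy, rfl⟩
        obtain ⟨z, hz⟩ := hKs ⟨y, hy⟩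
        refine ⟨z.1, z.2, b_cancel ?_⟩
        refine Eq.trans ?_ (b_bInvA (XiSum.hasSimplePole Λ N p) _).symm
        exact congrArg (fun w : K.toSubmodule => ((w : H.toSubmodule) : XiSum Λ N p)) hz.symm
    rw [eq_top_iff]
    rintro ⟨x, hx⟩ -
    obtain ⟨y, hy, hyx⟩ := (hH.trans_le (sInf_le hmem)) hx
    have : y = ⟨x, hx⟩ := Subtype.ext hyx
    exact this ▸ hy

theorem eq_of_sub_eq_intCast {l l' : ℚ} (h0 : 0 < l) (h1 : l ≤ 1) (h0' : 0 < l') (h1' : l' ≤ 1)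
    {z : ℤ} (h : l' - l = z) : l' = l := by
  have hz1 : z < 1 := by
    have : (z : ℚ) < 1 := by rw [← h]; linarith
    exact_mod_cast this
  have hz2 : -1 < z := by
    have : (-1 : ℚ) < z := by rw [← h]; linarith
    exact_mod_cast this
  have hz : z = 0 := by omega
  rw [hz, Int.cast_zero] at h
  linarith

/-- Conversely, only the exponents `l - 1 + ℕ` occur in an `[l]`-primitive module of
expansions. -/
theorem IsPrimitive.apply_eq_zero {j : F →ₗ[ℂ⟦X⟧] XiSum Λ N p} (hj : IsABLinear j)
    (hinj : Function.Injective j) {l : ℚ} (h0 : 0 < l) (h1 : l ≤ 1)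
    (hΛ : ∀ l ∈ Λ, 0 < l ∧ l ≤ 1) (hF : IsPrimitive F {l}) (x : F) (q : Fin p) (l' : Λ)
    (hl : (l' : ℚ) ≠ l) : j x q l' = 0 := by
  obtain ⟨G, i, hi⟩ := exists_isSaturation hj hinj
  set B := bernsteinOfSimplePole hi.1 with hB
  have hroot : ∀ r : ℂ, B.eval r = 0 → ∃ n : ℤ, r = -(l : ℂ) + n := fun r hr => by
    obtain ⟨_, rfl, h⟩ := hF.2 B ⟨G, i, hi.1, hi, hB⟩ r hr
    exact h
  let Q : ℕ → Polynomial ℂ := fun K => ∏ n ∈ Finset.range K,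
    (B.comp (-Polynomial.X)).comp (Polynomial.X - Polynomial.C (n : ℂ))
  have hQ : ∀ K g, ∃ z, polyD hi.1 (Q K) g = (X ^ K : ℂ⟦X⟧) • z := fun K g => by
    induction K with
    | zero => exact ⟨g, by simp [Q]⟩
    | succ K ih =>
      obtain ⟨z, hz⟩ := ih
      obtain ⟨y, hy⟩ := polyD_bernsteinOfSimplePole hi.1 z
      refine ⟨y, ?_⟩
      simp only [Q] at hz ⊢
      rw [Finset.prod_range_succ, mul_comm, polyD_mul, hz, polyD_X_pow_smul,
        Polynomial.comp_assoc _ _ (Polynomial.X + Polynomial.C (K : ℂ)), Polynomial.sub_comp,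
        Polynomial.X_comp, Polynomial.C_comp, add_sub_cancel_right, Polynomial.comp_X, hy, pow_succ, mul_smul]
  obtain ⟨m, hm⟩ := exists_transfer (XiSum.hasSimplePole Λ N p) hi.1 hj hi.2.1 hi.2.2.1
  have hcomp : ∀ n, XiSum.comp q l' n (j x) = 0 := fun n => by
    obtain ⟨e, he⟩ := hm (Q (m + (n + 1))) (m + (n + 1)) (fun x => hQ _ _) x
    refine eq_zero_of_aeval_jordan_eq_zero (r := ((l' : ℚ) : ℂ) + n) (p := Q (m + (n + 1))) ?_ ?_
    · rw [Polynomial.eval_prod, Finset.prod_ne_zero_iff]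
      intro k _ hk
      rw [Polynomial.eval_comp, Polynomial.eval_comp] at hk
      obtain ⟨z, hz⟩ := hroot _ hk
      simp only [Polynomial.eval_sub, Polynomial.eval_X, Polynomial.eval_C,
        Polynomial.eval_neg] at hz
      have hz' : (l' : ℚ) - l = ((k - n - z : ℤ) : ℚ) := by
        have : (((l' : ℚ) - l : ℚ) : ℂ) = (((k - n - z : ℤ) : ℚ) : ℂ) := by
          push_cast
          linear_combination -hz
        exact_mod_cast this
      exact hl (eq_of_sub_eq_intCast h0 h1 (hΛ _ l'.2).1 (hΛ _ l'.2).2 hz')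
    · rw [← XiSum.comp_polyD, ← XiSum.comp_X_pow_smul q l' n m, he,
        XiSum.comp_X_pow_smul_of_lt q l' (by omega)]
  funext k
  exact PowerSeries.ext fun n => (congrFun (hcomp n) k).trans (map_zero _).symm

/-- The `[l]`-primitive part of a module of expansions consists of the elements whose exponents
lie in `l - 1 + ℕ`. -/
theorem mem_primitivePart_iff {j : F →ₗ[ℂ⟦X⟧] XiSum Λ N p} (hj : IsABLinear j)
    (hinj : Function.Injective j) {l : ℚ} (h0 : 0 < l) (h1 : l ≤ 1)
    (hΛ : ∀ l ∈ Λ, 0 < l ∧ l ≤ 1) (x : F) :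
    x ∈ (primitivePart F {l}).toSubmodule ↔ ∀ q (l' : Λ), (l' : ℚ) ≠ l → j x q l' = 0 := by
  constructor
  · intro hx
    change x ∈ ⨆ H : {H : ABSubmodule F // IsPrimitive H.toSubmodule {l}}, H.1.toSubmodule at hx
    induction hx using Submodule.iSup_induction' with
    | mem H x hx =>
      exact H.2.apply_eq_zero (hj.compose (isABLinear_subtype H.1))
        (hinj.comp Subtype.val_injective) h0 h1 hΛ ⟨x, hx⟩
    | zero => intro q l' _; rw [map_zero]; rfl
    | add x y _ _ hx hy =>
      intro q l' hl
      rw [map_add, Pi.add_apply, Pi.add_apply, hx q l' hl, hy q l' hl, add_zero]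
  · intro hx
    obtain ⟨H, hH⟩ : ∃ H : ABSubmodule F, ∀ x, x ∈ H.toSubmodule ↔
        ∀ q (l' : Λ), (l' : ℚ) ≠ l → j x q l' = 0 :=
      ⟨{ carrier := {x | ∀ q (l' : Λ), (l' : ℚ) ≠ l → j x q l' = 0}
         add_mem' := fun {x y} hx hy q l' hl => by
           rw [map_add, Pi.add_apply, Pi.add_apply, hx q l' hl, hy q l' hl, add_zero]
         zero_mem' := fun q l' _ => by rw [map_zero]; rfl
         smul_mem' := fun S x hx q l' hl => by
           rw [map_smul, Pi.smul_apply, Pi.smul_apply, hx q l' hl, smul_zero]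
         a_mem := fun x hx q l' hl => by
           rw [hj]
           change ABAction.a (j x q l') = 0
           rw [hx q l' hl, map_zero] }, fun x => Iff.rfl⟩
    have hHp : IsPrimitive H.toSubmodule {l} :=
      isPrimitive_of_component (hj.compose (isABLinear_subtype H))
        (hinj.comp Subtype.val_injective) l fun x q l' hl => (hH x.1).1 x.2 q l' hl
    exact Submodule.mem_iSup_of_mem
      (p := fun H : {H : ABSubmodule F // IsPrimitive H.toSubmodule {l}} => H.1.toSubmodule)
      ⟨H, hHp⟩ ((hH x).2 hx)

end Primitive

/-! ### Splitting a module of expansions into its primitive parts -/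

section Splitting

variable {Λ : Finset ℚ} {N p : ℕ}

/-- The projection of an expansion on its part with exponents in `l - 1 + ℕ`. -/
def XiSum.proj (l : Λ) (x : XiSum Λ N p) : XiSum Λ N p :=
  fun q => Pi.single l (x q l)

theorem XiSum.proj_apply_of_ne (l : Λ) (x : XiSum Λ N p) (q : Fin p) {l' : Λ} (h : l' ≠ l) :
    XiSum.proj l x q l' = 0 :=
  Pi.single_eq_of_ne (M := fun l : Λ => Xi l N) h _

theorem XiSum.comp_proj_self (l : Λ) (x : XiSum Λ N p) (q : Fin p) (n : ℕ) :
    XiSum.comp q l n (XiSum.proj l x) = XiSum.comp q l n x := by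
  funext k
  rw [XiSum.comp_apply, XiSum.comp_apply, XiSum.proj, Pi.single_eq_same]

theorem XiSum.comp_proj_of_ne (l : Λ) (x : XiSum Λ N p) (q : Fin p) {l' : Λ} (h : l' ≠ l)
    (n : ℕ) : XiSum.comp q l' n (XiSum.proj l x) = 0 := by
  funext k
  rw [XiSum.comp_apply, XiSum.proj_apply_of_ne l x q h]
  exact map_zero _

/-- Submodules of a finite module are closed in the `b`-adic topology, by Krull's intersection
theorem for the quotient. -/
theorem mem_of_forall_exists_X_pow {G : Type*} [AddCommGroup G] [Module ℂ⟦X⟧ G]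
    [Module.Finite ℂ⟦X⟧ G] (S : Submodule ℂ⟦X⟧ G) (x : G)
    (h : ∀ K : ℕ, ∃ y ∈ S, ∃ z, x = y + (X ^ K : ℂ⟦X⟧) • z) : x ∈ S := by
  rw [← Submodule.Quotient.mk_eq_zero, ← Submodule.mem_bot (R := ℂ⟦X⟧),
    ← Ideal.iInf_pow_smul_eq_bot_of_isLocalRing (M := G ⧸ S) (Ideal.span {(X : ℂ⟦X⟧)})
      (by rw [Ne, Ideal.span_singleton_eq_top]; exact X_prime.not_isUnit), Submodule.mem_iInf]
  intro K
  obtain ⟨y, hy, z, rfl⟩ := h K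
  rw [Submodule.Quotient.mk_add, (Submodule.Quotient.mk_eq_zero S).2 hy, zero_add,
    Submodule.Quotient.mk_smul]
  exact Submodule.smul_mem_smul (Ideal.pow_mem_pow (Ideal.mem_span_singleton_self _) K)
    Submodule.mem_top

/-- A submodule stable under `b⁻¹ a` contains the projections of its elements: modulo `b^K`, the
projection is a polynomial in `b⁻¹ a`, as the eigenvalues on distinct components are distinct. -/
theorem XiSum.proj_mem (hΛ : ∀ l ∈ Λ, 0 < l ∧ l ≤ 1) (S : Submodule ℂ⟦X⟧ (XiSum Λ N p))
    (hS : ∀ x ∈ S, bInvA (XiSum.hasSimplePole Λ N p) x ∈ S) (l : Λ) {x : XiSum Λ N p}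
    (hx : x ∈ S) : XiSum.proj l x ∈ S := by
  refine mem_of_forall_exists_X_pow S _ fun K => ?_
  let f : Λ → ℕ → Polynomial ℂ := fun l' n =>
    (Polynomial.X - Polynomial.C (((l' : ℚ) : ℂ) + n)) ^ (N + 1)
  have hco : IsCoprime (∏ l' ∈ Finset.univ.erase l, ∏ n ∈ Finset.range K, f l' n)
      (∏ n ∈ Finset.range K, f l n) := by
    refine IsCoprime.prod_left fun l' hl' => IsCoprime.prod_left fun n _ =>
      IsCoprime.prod_right fun k _ => IsCoprime.pow ?_
    refine Polynomial.isCoprime_X_sub_C_of_isUnit_sub (isUnit_iff_ne_zero.2 fun h0 => ?_)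
    have hlk : (l' : ℚ) - l = ((k - n : ℤ) : ℚ) := by
      have : (((l' : ℚ) - l : ℚ) : ℂ) = (((k - n : ℤ) : ℚ) : ℂ) := by
        push_cast
        linear_combination h0
      exact_mod_cast this
    exact (Finset.mem_erase.1 hl').1 (Subtype.ext (eq_of_sub_eq_intCast (hΛ _ l.2).1
      (hΛ _ l.2).2 (hΛ _ l'.2).1 (hΛ _ l'.2).2 hlk))
  obtain ⟨u, w, huw⟩ := hco
  set A := ∏ l' ∈ Finset.univ.erase l, ∏ n ∈ Finset.range K, f l' n with hA
  set B := ∏ n ∈ Finset.range K, f l n with hB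
  have hkill : ∀ l' : Λ, ∀ n < K, ∀ Q : Polynomial ℂ, ∏ n ∈ Finset.range K, f l' n ∣ Q →
      Polynomial.aeval (jordan N (((l' : ℚ) : ℂ) + n)) Q = 0 := fun l' n hn Q hQ =>
    aeval_jordan_eq_zero_of_dvd
      ((Finset.dvd_prod_of_mem (f l') (Finset.mem_range.2 hn)).trans hQ)
  obtain ⟨z, hz⟩ := XiSum.exists_X_pow_smul (K := K)
    (x := XiSum.proj l x - polyD (XiSum.hasSimplePole Λ N p) (u * A) x) (by
      intro q l' n hn
      rw [map_sub, XiSum.comp_polyD]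
      by_cases hll : l' = l
      · subst hll
        rw [XiSum.comp_proj_self, eq_sub_of_add_eq huw, map_sub, map_one,
          hkill l' n hn _ (dvd_mul_left _ _), sub_zero, Module.End.one_apply, sub_self]
      · rw [XiSum.comp_proj_of_ne l x q hll, hkill l' n hn, LinearMap.zero_apply, sub_zero]
        refine Dvd.dvd.mul_left ?_ u
        exact Finset.dvd_prod_of_mem (fun l' => ∏ n ∈ Finset.range K, f l' n)
          (Finset.mem_erase.2 ⟨hll, Finset.mem_univ _⟩))
  exact ⟨_, polyD_mem _ S hS _ x hx, z, by rw [← hz, add_sub_cancel]⟩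

variable {E : Type u} [AddCommGroup E] [Module ℂ⟦X⟧ E]

/-- The coefficient of `s^{l-1}` in the component of index `(q, l)`. -/
def noLogFunctional (j : E →ₗ[ℂ⟦X⟧] XiSum Λ N p) (i : Fin p × Λ) : E →ₗ[ℂ⟦X⟧] ℂ⟦X⟧ where
  toFun x := j x i.1 i.2 0
  map_add' x y := by rw [map_add]; rfl
  map_smul' S x := by rw [map_smul]; rfl

theorem noLogFunctional_apply (j : E →ₗ[ℂ⟦X⟧] XiSum Λ N p) (i : Fin p × Λ) (x : E) :
    noLogFunctional j i x = j x i.1 i.2 0 := rfl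

theorem apply_eq_zero_of_logDeriv {j : E →ₗ[ℂ⟦X⟧] XiSum Λ N p}
    (hlog : ∀ x q l n, logDeriv N (XiSum.comp q l n (j x)) = 0) (x : E) (q : Fin p) (l : Λ)
    {k : Fin (N + 1)} (hk : k ≠ 0) : j x q l k = 0 :=
  PowerSeries.ext fun n =>
    (eq_zero_of_logDeriv_eq_zero (hlog x q l n) k hk).trans (map_zero _).symm

theorem eq_zero_of_noLogFunctional {j : E →ₗ[ℂ⟦X⟧] XiSum Λ N p} (hinj : Function.Injective j)
    (hlog : ∀ x q l n, logDeriv N (XiSum.comp q l n (j x)) = 0) (x : E)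
    (hx : ∀ i, noLogFunctional j i x = 0) : x = 0 := by
  apply hinj
  rw [map_zero]
  funext q l
  funext k
  by_cases hk : k = 0
  · rw [hk]; exact hx (q, l)
  · exact apply_eq_zero_of_logDeriv hlog x q l hk

variable [ABAction E]

theorem noLogFunctional_a {j : E →ₗ[ℂ⟦X⟧] XiSum Λ N p} (hj : IsABLinear j)
    (hlog : ∀ x q l n, logDeriv N (XiSum.comp q l n (j x)) = 0) (i : Fin p × Λ) (x : E) :
    noLogFunctional j i (ABAction.a x) =
      rankOneA (((i.2 : ℚ) : ℂ)) (noLogFunctional j i x) := by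
  have h1 : (j x i.1 i.2).coef ((0 : Fin (N + 1)) + 1 : ℕ) = 0 := by
    unfold Xi.coef
    split_ifs with h
    · exact apply_eq_zero_of_logDeriv hlog x i.1 i.2 (Fin.ne_of_val_ne (by simp))
    · rfl
  rw [noLogFunctional_apply, hj, XiSum.a_apply, h1, Xi.coef_fin, rankOneA_apply,
    noLogFunctional_apply]
  ring

/-- If all primitive parts are semi-simple, no logarithm occurs: up to a power of `b`, the
components of the elements belong to the primitive parts. -/
theorem logDeriv_comp_eq_zero_of_primitivePart (hΛ : ∀ l ∈ Λ, 0 < l ∧ l ≤ 1)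
    {j : E →ₗ[ℂ⟦X⟧] XiSum Λ N p} (hj : IsABLinear j) (hinj : Function.Injective j)
    (hE : ∀ l : ℚ, 0 < l → l ≤ 1 → IsSemiSimple (primitivePart E {l}).toSubmodule)
    (x : E) (q : Fin p) (l : Λ) (n : ℕ) : logDeriv N (XiSum.comp q l n (j x)) = 0 := by
  let S : Submodule ℂ⟦X⟧ (XiSum Λ N p) :=
    { carrier := {y | ∃ (k : ℕ) (e : E), (X ^ k : ℂ⟦X⟧) • y = j e}
      add_mem' := by
        rintro y y' ⟨k, e, h⟩ ⟨k', e', h'⟩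
        refine ⟨k + k', (X ^ k' : ℂ⟦X⟧) • e + (X ^ k : ℂ⟦X⟧) • e', ?_⟩
        rw [map_add, map_smul, map_smul, ← h, ← h', smul_add, smul_smul, smul_smul, pow_add,
          mul_comm (X ^ k' : ℂ⟦X⟧)]
      zero_mem' := ⟨0, 0, by rw [map_zero, smul_zero]⟩
      smul_mem' := by
        rintro c y ⟨k, e, h⟩
        exact ⟨k, c • e, by rw [smul_comm, h, map_smul]⟩ }
  obtain ⟨k, e, he⟩ : XiSum.proj l (j x) ∈ S := XiSum.proj_mem hΛ S
    (by
      rintro y ⟨k, e, h⟩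
      exact ⟨k + 1, _, X_pow_succ_smul_bInvA (XiSum.hasSimplePole Λ N p) hj h⟩)
    l ⟨0, x, by rw [pow_zero, one_smul]⟩
  have hmem : e ∈ (primitivePart E {(l : ℚ)}).toSubmodule := by
    rw [mem_primitivePart_iff hj hinj (hΛ _ l.2).1 (hΛ _ l.2).2 hΛ]
    intro q' l' hl'
    rw [← he, Pi.smul_apply, Pi.smul_apply,
      XiSum.proj_apply_of_ne l (j x) q' (fun h => hl' (congrArg Subtype.val h)), smul_zero]
  have h := (hE l (hΛ _ l.2).1 (hΛ _ l.2).2).logDeriv_comp_eq_zero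
    (hj.compose (isABLinear_subtype _)) ⟨e, hmem⟩ q l (n + k)
  change logDeriv N (XiSum.comp q l (n + k) (j e)) = 0 at h
  rwa [← he, XiSum.comp_X_pow_smul, XiSum.comp_proj_self] at h

end Splitting

/-! ### Cyclic semi-simple modules -/

section Cyclic

variable {E : Type u} [AddCommGroup E] [Module ℂ⟦X⟧ E]

/-- The span of the first `j` vectors of a sequence. -/
def flag (e : ℕ → E) (j : ℕ) : Submodule ℂ⟦X⟧ E :=
  Submodule.span ℂ⟦X⟧ (e '' Set.Iio j)

theorem flag_congr {e e' : ℕ → E} {j : ℕ}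
    (h : ∀ i < j, e i = e' i) : flag e j = flag e' j := by
  rw [flag, flag, Set.image_congr (s := Set.Iio j) (fun i hi => h i hi)]

theorem flag_succ (e : ℕ → E) (j : ℕ) :
    flag e (j + 1) = Submodule.span ℂ⟦X⟧ {e j} ⊔ flag e j := by
  rw [flag, flag, ← Submodule.span_union, ← Set.image_singleton, ← Set.image_union]
  congr 2
  ext i
  simp only [Set.mem_Iio, Set.mem_union, Set.mem_singleton_iff]
  omega

theorem flag_zero (e : ℕ → E) : flag e 0 = ⊥ := by
  rw [flag, Set.eq_empty_of_forall_notMem (s := Set.Iio 0) (fun i hi => Nat.not_lt_zero i hi),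
    Set.image_empty, Submodule.span_empty]

theorem flag_mono (e : ℕ → E) {i j : ℕ} (h : i ≤ j) : flag e i ≤ flag e j :=
  Submodule.span_mono (Set.image_mono (Set.Iio_subset_Iio h))

theorem mem_flag_succ {e : ℕ → E} {j : ℕ} {x : E} :
    x ∈ flag e (j + 1) ↔ ∃ S : ℂ⟦X⟧, x - S • e j ∈ flag e j := by
  rw [flag_succ, Submodule.mem_sup]
  constructor
  · rintro ⟨_, hs, w, hw, rfl⟩
    obtain ⟨S, rfl⟩ := Submodule.mem_span_singleton.1 hs
    exact ⟨S, by rwa [add_sub_cancel_left]⟩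
  · rintro ⟨S, hS⟩
    exact ⟨S • e j, Submodule.mem_span_singleton.2 ⟨S, rfl⟩, _, hS, add_sub_cancel _ _⟩

variable [ABAction E]

theorem mem_generatedBy_self (x : E) : x ∈ (generatedBy x).toSubmodule :=
  Submodule.mem_sInf.2 fun _ hH => hH.1

theorem generatedBy_le {x : E} {S : Submodule ℂ⟦X⟧ E} (hx : x ∈ S)
    (hS : ∀ y ∈ S, ABAction.a y ∈ S) : (generatedBy x).toSubmodule ≤ S :=
  sInf_le ⟨hx, hS⟩

theorem generatedBy_le_of_mem {x y : E} (h : x ∈ (generatedBy y).toSubmodule) :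
    (generatedBy x).toSubmodule ≤ (generatedBy y).toSubmodule :=
  generatedBy_le h (generatedBy y).a_mem

theorem generatedBy_units_smul (u : ℂ⟦X⟧ˣ) (x : E) :
    (generatedBy ((u : ℂ⟦X⟧) • x)).toSubmodule = (generatedBy x).toSubmodule := by
  refine le_antisymm (generatedBy_le_of_mem (Submodule.smul_mem _ _ (mem_generatedBy_self x)))
    (generatedBy_le_of_mem ?_)
  have h := Submodule.smul_mem _ (↑u⁻¹ : ℂ⟦X⟧) (mem_generatedBy_self ((u : ℂ⟦X⟧) • x))
  rwa [smul_smul, Units.inv_mul, one_smul] at h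

/-- Since `a x` is a combination of `x` and `y = (a - c b) x`, the module generated by `x` is
spanned by `x` and the module generated by `y`. -/
theorem mem_generatedBy_iff (c : ℂ) (x z : E) :
    z ∈ (generatedBy x).toSubmodule ↔ ∃ S : ℂ⟦X⟧, ∃ w ∈
      (generatedBy (ABAction.a x - (C c * X : ℂ⟦X⟧) • x)).toSubmodule, z = S • x + w := by
  set y := ABAction.a x - (C c * X : ℂ⟦X⟧) • x with hy
  have hyx : (generatedBy y).toSubmodule ≤ (generatedBy x).toSubmodule :=
    generatedBy_le_of_mem (Submodule.sub_mem _
      ((generatedBy x).a_mem _ (mem_generatedBy_self x))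
      (Submodule.smul_mem _ _ (mem_generatedBy_self x)))
  constructor
  · intro hz
    have hle : (generatedBy x).toSubmodule ≤
        Submodule.span ℂ⟦X⟧ {x} ⊔ (generatedBy y).toSubmodule := by
      refine generatedBy_le (Submodule.mem_sup_left (Submodule.mem_span_singleton_self x)) ?_
      intro v hv
      obtain ⟨_, hs, w, hw, rfl⟩ := Submodule.mem_sup.1 hv
      obtain ⟨S, rfl⟩ := Submodule.mem_span_singleton.1 hs
      refine Submodule.mem_sup.2 ⟨(S * (C c * X) + X ^ 2 * derivative ℂ S) • x,
        Submodule.mem_span_singleton.2 ⟨_, rfl⟩, S • y + ABAction.a w,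
        Submodule.add_mem _ (Submodule.smul_mem _ _ (mem_generatedBy_self y))
          ((generatedBy y).a_mem _ hw), ?_⟩
      rw [map_add, ABAction.a_smul, hy, smul_sub, add_smul, smul_smul]
      abel
    obtain ⟨_, hs, w, hw, rfl⟩ := Submodule.mem_sup.1 (hle hz)
    obtain ⟨S, rfl⟩ := Submodule.mem_span_singleton.1 hs
    exact ⟨S, w, hw, rfl⟩
  · rintro ⟨S, w, hw, rfl⟩
    exact Submodule.add_mem _ (Submodule.smul_mem _ _ (mem_generatedBy_self x)) (hyx hw)

theorem functional_eq_zero_of_mem_generatedBy {c : ℂ} {g : E →ₗ[ℂ⟦X⟧] ℂ⟦X⟧}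
    (hg : ∀ x, g (ABAction.a x) = rankOneA c (g x)) {x z : E} (hx : g x = 0)
    (hz : z ∈ (generatedBy x).toSubmodule) : g z = 0 :=
  (generatedBy_le (S := LinearMap.ker g) hx fun y hy => by
    rw [LinearMap.mem_ker] at hy ⊢
    rw [hg, hy, map_zero]) hz

theorem rankOneA_sub_eq_zero (c : ℂ) (n : ℕ) :
    rankOneA c (X ^ n) - C (c + n) * X * X ^ n = 0 := by
  rw [rankOneA_apply, X_sq_mul_derivative_X_pow, map_add]
  ring

/-- Let `g` be a functional with values in `E_c` which does not vanish at `x`. Up to a unit,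
`g x = bⁿ`, which is killed by `a - (c + n) b`. Hence the kernel of `g` on the module generated
by `x` is generated by `(a - (c + n) b) x`. -/
theorem exists_generatedBy_inf_ker {c : ℂ} {g : E →ₗ[ℂ⟦X⟧] ℂ⟦X⟧}
    (hg : ∀ x, g (ABAction.a x) = rankOneA c (g x)) {x : E} {n : ℕ} {v : ℂ⟦X⟧ˣ}
    (hn : g x = X ^ n * (v : ℂ⟦X⟧)) :
    ∃ u : ℂ⟦X⟧ˣ, g ((u : ℂ⟦X⟧) • x) = X ^ n ∧
      ∀ z, z ∈ (generatedBy (ABAction.a ((u : ℂ⟦X⟧) • x) -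
          (C (c + n) * X : ℂ⟦X⟧) • (u : ℂ⟦X⟧) • x)).toSubmodule ↔
        z ∈ (generatedBy x).toSubmodule ∧ g z = 0 := by
  have hgu : g (((v⁻¹ : ℂ⟦X⟧ˣ) : ℂ⟦X⟧) • x) = X ^ n := by
    rw [map_smul, hn, smul_eq_mul, mul_left_comm, Units.inv_mul, mul_one]
  refine ⟨v⁻¹, hgu, fun z => ?_⟩
  have hy : g (ABAction.a (((v⁻¹ : ℂ⟦X⟧ˣ) : ℂ⟦X⟧) • x) -
      (C (c + n) * X : ℂ⟦X⟧) • ((v⁻¹ : ℂ⟦X⟧ˣ) : ℂ⟦X⟧) • x) = 0 := by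
    rw [map_sub, hg, map_smul g (C (c + n) * X), hgu, smul_eq_mul, rankOneA_sub_eq_zero]
  rw [← generatedBy_units_smul v⁻¹ x, mem_generatedBy_iff (c + n) (((v⁻¹ : ℂ⟦X⟧ˣ) : ℂ⟦X⟧) • x)]
  constructor
  · exact fun hz => ⟨⟨0, z, hz, by rw [zero_smul, zero_add]⟩,
      functional_eq_zero_of_mem_generatedBy hg hy hz⟩
  · rintro ⟨⟨S, w, hw, rfl⟩, hz⟩
    rw [map_add, functional_eq_zero_of_mem_generatedBy hg hy hw, add_zero, map_smul, hgu,
      smul_eq_mul] at hz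
    rw [(mul_eq_zero.1 hz).resolve_right (pow_ne_zero n X_ne_zero), zero_smul, zero_add]
    exact hw

theorem exists_eq_X_pow_mul_unit {S : ℂ⟦X⟧} (hS : S ≠ 0) :
    ∃ (n : ℕ) (v : ℂ⟦X⟧ˣ), S = X ^ n * (v : ℂ⟦X⟧) :=
  ⟨S.order.toNat, Unit_of_divided_by_X_pow_order S, by
    rw [Unit_of_divided_by_X_pow_order_nonzero hS, X_pow_order_mul_divXPowOrder]⟩

theorem exists_generatedBy_inf_iInf_ker {ι : Type*} (s : Finset ι) {c : ι → ℂ}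
    {g : ι → E →ₗ[ℂ⟦X⟧] ℂ⟦X⟧} (hg : ∀ i x, g i (ABAction.a x) = rankOneA (c i) (g i x)) (x : E) :
    ∃ y, ∀ z, z ∈ (generatedBy y).toSubmodule ↔
      z ∈ (generatedBy x).toSubmodule ∧ ∀ i ∈ s, g i z = 0 := by
  classical
  induction s using Finset.induction_on with
  | empty => exact ⟨x, fun z => by simp⟩
  | insert i s _ ih =>
    obtain ⟨y, hy⟩ := ih
    have key : ∃ y', ∀ z, z ∈ (generatedBy y').toSubmodule ↔
        z ∈ (generatedBy y).toSubmodule ∧ g i z = 0 := by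
      by_cases h0 : g i y = 0
      · exact ⟨y, fun z => ⟨fun hz =>
          ⟨hz, functional_eq_zero_of_mem_generatedBy (hg i) h0 hz⟩, fun hz => hz.1⟩⟩
      · obtain ⟨n, v, hn⟩ := exists_eq_X_pow_mul_unit h0
        obtain ⟨u, -, hu⟩ := exists_generatedBy_inf_ker (hg i) hn
        exact ⟨_, hu⟩
    obtain ⟨y', hy'⟩ := key
    refine ⟨y', fun z => ?_⟩
    rw [hy', hy, Finset.forall_mem_insert]
    tauto

/-- The vectors `e_0, ..., e_{k-1}` are independent and `a e_j` is `μ_j b e_j` modulo the previous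
vectors: they form a basis adapted to a Jordan–Hölder sequence. -/
structure IsTriangular (k : ℕ) (e : ℕ → E) (μ : ℕ → ℚ) : Prop where
  indep : ∀ j < k, ∀ S : ℂ⟦X⟧, S • e j ∈ flag e j → S = 0
  a_sub_mem : ∀ j < k, ABAction.a (e j) - (C (μ j : ℂ) * X : ℂ⟦X⟧) • e j ∈ flag e j

theorem X_pow_dvd_rankOneA_sub {c : ℂ} {n : ℕ} {S : ℂ⟦X⟧} (h : X ^ n ∣ S) :
    X ^ (n + 2) ∣ rankOneA c S - C (c + n) * X * S := by
  obtain ⟨T, rfl⟩ := h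
  refine ⟨derivative ℂ T, ?_⟩
  rw [rankOneA_apply, Derivation.leibniz, smul_eq_mul, smul_eq_mul, mul_add,
    mul_left_comm _ T, X_sq_mul_derivative_X_pow, map_add]
  ring

/-- If all the functionals take their values in the same `E_c`, the modules generated by one
element have an adapted basis with `μ_j + j` strictly decreasing. The last quotient is given by a
functional `g_i` of minimal order `n` at the generator `x`: the kernel of `g_i` is generated by
`(a - (c + n) b) x`, and this operator kills `bⁿ` in `E_c`, so that the orders at the new generator
are at least `n + 2`. -/
theorem exists_isTriangular {ι : Type*} [Fintype ι] {c : ι → ℂ} {c₀ : ℚ}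
    {g : ι → E →ₗ[ℂ⟦X⟧] ℂ⟦X⟧} (hg : ∀ i x, g i (ABAction.a x) = rankOneA (c i) (g i x))
    (hinj : ∀ x, (∀ i, g i x = 0) → x = 0) (x : E) (n : ℕ)
    (hc : ∀ i, g i x ≠ 0 → c i = c₀) (hn : ∀ i, X ^ n ∣ g i x) :
    ∃ (k : ℕ) (e : ℕ → E) (μ : ℕ → ℚ), IsTriangular k e μ ∧
      flag e k = (generatedBy x).toSubmodule ∧
      (∀ i j, i < j → j < k → μ j + j < μ i + i) ∧ ∀ j < k, c₀ + n ≤ μ j := by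
  classical
  induction hs : (Finset.univ.filter fun i => g i x ≠ 0).card using Nat.strong_induction_on
    generalizing x n with
  | _ s ih =>
  subst hs
  by_cases hx : ∀ i, g i x = 0
  · refine ⟨0, fun _ => 0, fun _ => 0, ⟨by simp, by simp⟩, ?_, by simp, by simp⟩
    rw [flag_zero, eq_comm, eq_bot_iff, hinj x hx]
    exact generatedBy_le (Submodule.mem_bot _ |>.2 rfl) fun y hy => by
      rw [Submodule.mem_bot] at hy ⊢; rw [hy, map_zero]
  · -- `m` is the minimal order of the `g i x`, and it is attained at `i₀`.
    obtain ⟨m, ⟨i₀, v, hv⟩, hmin⟩ : ∃ m : ℕ, (∃ (i : ι) (v : ℂ⟦X⟧ˣ), g i x = X ^ m * (v : ℂ⟦X⟧)) ∧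
        ∀ i, X ^ m ∣ g i x := by
      have hex : ∃ m : ℕ, ∃ (i : ι) (v : ℂ⟦X⟧ˣ), g i x = X ^ m * (v : ℂ⟦X⟧) := by
        push Not at hx
        obtain ⟨i, hi⟩ := hx
        obtain ⟨m, v, h⟩ := exists_eq_X_pow_mul_unit hi
        exact ⟨m, i, v, h⟩
      refine ⟨Nat.find hex, Nat.find_spec hex, fun i => ?_⟩
      by_cases hi : g i x = 0
      · rw [hi]; exact dvd_zero _
      · obtain ⟨m, v, h⟩ := exists_eq_X_pow_mul_unit hi
        rw [h]
        exact Dvd.dvd.mul_right (pow_dvd_pow _ (Nat.find_min' hex ⟨i, v, h⟩)) _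
    have hi₀ : g i₀ x ≠ 0 := by
      rw [hv]; exact mul_ne_zero (pow_ne_zero m X_ne_zero) v.ne_zero
    have hnm : n ≤ m := by
      have h := hn i₀
      rw [hv, v.isUnit.dvd_mul_right] at h
      exact (pow_dvd_pow_iff X_ne_zero X_prime.not_isUnit).1 h
    obtain ⟨u, hu, hgen⟩ := exists_generatedBy_inf_ker (hg i₀) hv
    set x' := (u : ℂ⟦X⟧) • x with hx'
    set y := ABAction.a x' - (C (c i₀ + m) * X : ℂ⟦X⟧) • x' with hy
    have hgx' : ∀ i, g i x' = u * g i x := fun i => by rw [hx', map_smul, smul_eq_mul]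
    have hgy : ∀ i, g i y = rankOneA (c i) (g i x') - C (c i₀ + m) * X * g i x' := fun i => by
      rw [hy, map_sub, hg, map_smul (g i) (C (c i₀ + m) * X), smul_eq_mul]
    have hsupp : ∀ i, g i x = 0 → g i y = 0 := fun i hi => by
      rw [hgy, hgx', hi, mul_zero, map_zero, mul_zero, sub_zero]
    obtain ⟨k, e, μ, htri, hflag, hanti, hbound⟩ := ih _ (by
      refine Finset.card_lt_card (Finset.ssubset_iff_of_subset ?_ |>.2 ⟨i₀, ?_, ?_⟩)
      · intro i hi
        rw [Finset.mem_filter] at hi ⊢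
        exact ⟨hi.1, fun h0 => hi.2 (hsupp i h0)⟩
      · exact Finset.mem_filter.2 ⟨Finset.mem_univ _, hi₀⟩
      · intro hmem
        refine (Finset.mem_filter.1 hmem).2 ?_
        rw [hgy, hu, rankOneA_sub_eq_zero]) y (m + 2)
      (fun i hi => hc i fun h0 => hi (hsupp i h0))
      (fun i => by
        by_cases h0 : g i x = 0
        · rw [hsupp i h0]; exact dvd_zero _
        · rw [hgy, hc i₀ hi₀, ← hc i h0]
          exact X_pow_dvd_rankOneA_sub (by rw [hgx']; exact Dvd.dvd.mul_left (hmin i) _))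
      rfl
    set e' : ℕ → E := fun j => if j < k then e j else x' with he'
    set μ' : ℕ → ℚ := fun j => if j < k then μ j else c₀ + m with hμ'
    have he'k : e' k = x' := if_neg (lt_irrefl k)
    have hμ'k : μ' k = c₀ + m := if_neg (lt_irrefl k)
    have he'l : ∀ j < k, e' j = e j := fun j hj => if_pos hj
    have hμ'l : ∀ j < k, μ' j = μ j := fun j hj => if_pos hj
    have hfl : ∀ j ≤ k, flag e' j = flag e j := fun j hj =>
      flag_congr fun i hi => he'l i (hi.trans_le hj)
    refine ⟨k + 1, e', μ', ⟨fun j hj S hS => ?_, fun j hj => ?_⟩, ?_, fun i j hij hj => ?_,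
      fun j hj => ?_⟩
    · rcases Nat.lt_succ_iff_lt_or_eq.1 hj with hj | rfl
      · rw [he'l j hj, hfl j hj.le] at hS
        exact htri.indep j hj S hS
      · rw [hfl j le_rfl, hflag, he'k, hgen, map_smul, hu, smul_eq_mul] at hS
        exact (mul_eq_zero.1 hS.2).resolve_right (pow_ne_zero m X_ne_zero)
    · rcases Nat.lt_succ_iff_lt_or_eq.1 hj with hj | rfl
      · rw [he'l j hj, hμ'l j hj, hfl j hj.le]
        exact htri.a_sub_mem j hj
      · rw [hfl j le_rfl, hflag, he'k, hμ'k]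
        have : ((c₀ + m : ℚ) : ℂ) = c i₀ + m := by rw [hc i₀ hi₀]; push_cast; rfl
        rw [this]
        exact mem_generatedBy_self y
    · rw [flag_succ, hfl k le_rfl, hflag, he'k, ← generatedBy_units_smul u x]
      ext z
      rw [mem_generatedBy_iff (c i₀ + m) x' z, Submodule.mem_sup]
      constructor
      · rintro ⟨_, hs, w, hw, rfl⟩
        obtain ⟨S, rfl⟩ := Submodule.mem_span_singleton.1 hs
        exact ⟨S, w, hw, rfl⟩
      · rintro ⟨S, w, hw, rfl⟩
        exact ⟨_, Submodule.mem_span_singleton.2 ⟨S, rfl⟩, w, hw, rfl⟩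
    · rcases Nat.lt_succ_iff_lt_or_eq.1 hj with hj | rfl
      · rw [hμ'l j hj, hμ'l i (hij.trans hj)]
        exact hanti i j hij hj
      · rw [hμ'k, hμ'l i hij]
        obtain ⟨k, rfl⟩ : ∃ k', j = k' + 1 := Nat.exists_eq_succ_of_ne_zero (by omega)
        have h1 : μ k + k ≤ μ i + i := by
          rcases Nat.lt_succ_iff_lt_or_eq.1 hij with h | rfl
          · exact (hanti i k h k.lt_succ_self).le
          · exact le_rfl
        have h2 := hbound k k.lt_succ_self
        push_cast at h2 ⊢
        linarith
    · have hnm' : (n : ℚ) ≤ m := by exact_mod_cast hnm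
      rcases Nat.lt_succ_iff_lt_or_eq.1 hj with hj | rfl
      · rw [hμ'l j hj]
        have := hbound j hj
        push_cast at this
        linarith
      · rw [hμ'k]; linarith

end Cyclic

/-! ### Jordan–Hölder sequences and adapted bases -/

section JordanHolder

variable {E : Type u} [AddCommGroup E] [Module ℂ⟦X⟧ E] [ABAction E]

theorem ABIso.symm {E' : Type v} [AddCommGroup E'] [Module ℂ⟦X⟧ E'] [ABAction E']
    (h : ABIso E E') : ABIso E' E := by
  obtain ⟨f, hf⟩ := h
  refine ⟨f.symm, fun x => f.injective ?_⟩
  have := hf (f.symm x)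
  simp only [LinearEquiv.coe_coe, LinearEquiv.apply_symm_apply] at this ⊢
  exact this.symm

/-- A quotient generated by the class of `e`, free, with `a e = c b e` modulo `F`, is `E_c`. -/
theorem abIso_subQuot_rankOne (F G : ABSubmodule E) (c : ℂ) {e : E} (he : e ∈ G.toSubmodule)
    (hind : ∀ S : ℂ⟦X⟧, S • e ∈ F.toSubmodule → S = 0)
    (hgen : ∀ x ∈ G.toSubmodule, ∃ S : ℂ⟦X⟧, x - S • e ∈ F.toSubmodule)
    (ha : ABAction.a e - (C c * X : ℂ⟦X⟧) • e ∈ F.toSubmodule) :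
    ABIso (SubQuot F G) (RankOne c) := by
  let f : ℂ⟦X⟧ →ₗ[ℂ⟦X⟧] SubQuot F G :=
    (F.restrictTo G).toSubmodule.mkQ.comp (LinearMap.toSpanSingleton ℂ⟦X⟧ _ ⟨e, he⟩)
  have hf : ∀ S, f S = Submodule.Quotient.mk (S • (⟨e, he⟩ : G.toSubmodule)) := fun _ => rfl
  have hbij : Function.Bijective f := by
    constructor
    · rw [← LinearMap.ker_eq_bot, LinearMap.ker_eq_bot']
      intro S hS
      rw [hf, Submodule.Quotient.mk_eq_zero] at hS
      exact hind S hS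
    · intro x
      obtain ⟨x, rfl⟩ := Submodule.Quotient.mk_surjective _ x
      obtain ⟨S, hS⟩ := hgen x.1 x.2
      refine ⟨S, ?_⟩
      rw [hf, eq_comm, Submodule.Quotient.eq]
      exact hS
  have hiso : ABIso (RankOne c) (SubQuot F G) := by
    suffices h : ∀ S, f (rankOneA c S) = ABAction.a (f S) from
      ⟨LinearEquiv.ofBijective f hbij, h⟩
    intro S
    rw [hf, hf]
    change _ = Submodule.Quotient.mk (ABAction.a (S • (⟨e, he⟩ : G.toSubmodule)))
    rw [eq_comm, Submodule.Quotient.eq]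
    change ABAction.a (S • e) - (C c * X * S + X ^ 2 * derivative ℂ S) • e ∈ F.toSubmodule
    have : ABAction.a (S • e) - (C c * X * S + X ^ 2 * derivative ℂ S) • e =
        S • (ABAction.a e - (C c * X : ℂ⟦X⟧) • e) := by
      rw [ABAction.a_smul, smul_sub, smul_smul, add_smul, mul_comm S]
      abel
    rw [this]
    exact F.toSubmodule.smul_mem S ha
  exact hiso.symm

theorem exists_of_abIso_rankOne {F G : ABSubmodule E} {c : ℂ}
    (h : ABIso (SubQuot F G) (RankOne c)) :
    ∃ e ∈ G.toSubmodule, (∀ S : ℂ⟦X⟧, S • e ∈ F.toSubmodule → S = 0) ∧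
      (∀ x ∈ G.toSubmodule, ∃ S : ℂ⟦X⟧, x - S • e ∈ F.toSubmodule) ∧
      ABAction.a e - (C c * X : ℂ⟦X⟧) • e ∈ F.toSubmodule := by
  obtain ⟨f, hf⟩ := h.symm
  obtain ⟨e, he⟩ := Submodule.Quotient.mk_surjective (F.restrictTo G).toSubmodule
    (f (1 : ℂ⟦X⟧))
  have hS : ∀ S : ℂ⟦X⟧, f S = Submodule.Quotient.mk (S • e) := fun S => by
    have h1 : f (S • (1 : ℂ⟦X⟧)) = S • f (1 : ℂ⟦X⟧) := map_smul f S (1 : ℂ⟦X⟧)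
    rw [smul_eq_mul, mul_one] at h1
    rw [h1, ← he, Submodule.Quotient.mk_smul]
  refine ⟨e.1, e.2, fun S hSe => ?_, fun x hx => ?_, ?_⟩
  · have h0 : f S = 0 := by
      rw [hS, Submodule.Quotient.mk_eq_zero]
      exact hSe
    exact (map_eq_zero_iff f f.injective).1 h0
  · obtain ⟨S, hSx⟩ : ∃ S : ℂ⟦X⟧, f S = Submodule.Quotient.mk ⟨x, hx⟩ := f.surjective _
    refine ⟨S, ?_⟩
    rw [hS, eq_comm, Submodule.Quotient.eq] at hSx
    exact hSx
  · have h1 : f (rankOneA c 1) = ABAction.a (f (1 : ℂ⟦X⟧)) := hf (1 : ℂ⟦X⟧)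
    have h2 : rankOneA c 1 = C c * X := by rw [rankOneA_apply]; simp
    rw [h2, hS, ← he] at h1
    exact (Submodule.Quotient.eq (F.restrictTo G).toSubmodule).1 h1.symm

theorem IsTriangular.a_mem_flag {k : ℕ} {e : ℕ → E} {μ : ℕ → ℚ} (h : IsTriangular k e μ) {j : ℕ}
    (hj : j ≤ k) : ∀ x ∈ flag e j, ABAction.a x ∈ flag e j := by
  induction j with
  | zero =>
    intro x hx
    rw [flag_zero, Submodule.mem_bot] at hx ⊢
    rw [hx, map_zero]
  | succ j ih =>
    intro x hx
    obtain ⟨S, hS⟩ := mem_flag_succ.1 hx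
    refine mem_flag_succ.2 ⟨S * (C (μ j : ℂ) * X) + X ^ 2 * derivative ℂ S, ?_⟩
    have h1 := (flag e j).add_mem (ih (by omega) _ hS)
      ((flag e j).smul_mem S (h.a_sub_mem j (by omega)))
    convert h1 using 1
    rw [map_sub, ABAction.a_smul, smul_sub, smul_smul, add_smul]
    abel

/-- The steps of the flag of an adapted basis are normal. -/
theorem IsTriangular.mem_flag_of_smul_mem {k : ℕ} {e : ℕ → E} {μ : ℕ → ℚ}
    (h : IsTriangular k e μ) {j i : ℕ} (hji : j + i ≤ k) {x : E} (hx : x ∈ flag e (j + i))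
    (hXx : (X : ℂ⟦X⟧) • x ∈ flag e j) : x ∈ flag e j := by
  induction i with
  | zero => exact hx
  | succ i ih =>
    obtain ⟨S, hS⟩ := mem_flag_succ.1 hx
    have h1 := (flag e (j + i)).sub_mem (flag_mono e (Nat.le_add_right j i) hXx)
      ((flag e (j + i)).smul_mem X hS)
    rw [smul_sub, sub_sub_cancel, smul_smul] at h1
    have h2 := (mul_eq_zero.1 (h.indep _ (by omega) _ h1)).resolve_left X_ne_zero
    rw [h2, zero_smul, sub_zero] at hS
    exact ih (by omega) hS

theorem IsTriangular.hasStrictlyDecreasingJH {k : ℕ} {e : ℕ → E} {μ : ℕ → ℚ}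
    (h : IsTriangular k e μ) (htop : flag e k = ⊤)
    (hanti : ∀ i j, i < j → j < k → μ j + j < μ i + i) : HasStrictlyDecreasingJH E := by
  let F : Fin (k + 1) → ABSubmodule E := fun j =>
    ⟨flag e j, h.a_mem_flag (Nat.lt_succ_iff.1 j.2)⟩
  have hiso : ∀ j : Fin k, ABIso (SubQuot (F j.castSucc) (F j.succ)) (RankOne (μ j : ℂ)) :=
    fun j => abIso_subQuot_rankOne (F j.castSucc) (F j.succ) _
      (mem_flag_succ.2 ⟨1, by rw [one_smul, sub_self]; exact Submodule.zero_mem _⟩)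
      (h.indep j j.2) (fun x hx => mem_flag_succ.1 hx) (h.a_sub_mem j j.2)
  refine ⟨k, F, fun j => μ j, ⟨flag_zero e, htop, fun j => flag_mono e (Nat.le_succ j),
    fun j => ?_, fun j => ?_⟩, hiso, fun i j hij => ?_⟩
  · refine le_antisymm ?_ ?_
    · rintro _ ⟨hx, y, -, rfl⟩
      refine ⟨y, h.mem_flag_of_smul_mem (j := j) (i := k - j) (by omega) ?_ hx, rfl⟩
      rw [Nat.add_sub_cancel' (Nat.lt_succ_iff.1 j.2), htop]
      exact Submodule.mem_top
    · rintro _ ⟨y, hy, rfl⟩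
      exact ⟨Submodule.smul_mem _ _ hy, y, trivial, rfl⟩
  · obtain ⟨f, -⟩ := hiso j
    exact f.finrank_eq.trans (Module.finrank_self ℂ⟦X⟧)
  · have := hanti i j hij j.2
    change μ j + ((j : ℕ) + 1 : ℚ) < μ i + ((i : ℕ) + 1 : ℚ)
    linarith

/-- A variant for an adapted basis of the image of an embedding. -/
theorem IsTriangular.hasStrictlyDecreasingJH_of_embedding {E' : Type v} [AddCommGroup E']
    [Module ℂ⟦X⟧ E'] [ABAction E'] {f : E' →ₗ[ℂ⟦X⟧] E} (hf : IsABLinear f)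
    (hinj : Function.Injective f) {k : ℕ} {e : ℕ → E} {μ : ℕ → ℚ}
    (h : IsTriangular k e μ) (hrange : flag e k = LinearMap.range f)
    (hanti : ∀ i j, i < j → j < k → μ j + j < μ i + i) : HasStrictlyDecreasingJH E' := by
  have hex : ∀ j, ∃ x, j < k → f x = e j := fun j => by
    by_cases hj : j < k
    · obtain ⟨x, hx⟩ : e j ∈ LinearMap.range f := hrange ▸ Submodule.subset_span ⟨j, hj, rfl⟩
      exact ⟨x, fun _ => hx⟩
    · exact ⟨0, fun h => absurd h hj⟩
  choose e' he' using hex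
  have hflag : ∀ j ≤ k, ∀ x, x ∈ flag e' j ↔ f x ∈ flag e j := fun j hj x => by
    have : flag e j = (flag e' j).map f := by
      rw [flag, flag, Submodule.map_span, Set.image_image]
      exact congrArg _ (Set.image_congr fun i hi => (he' i (lt_of_lt_of_le hi hj)).symm)
    rw [this]
    exact ⟨fun hx => ⟨x, hx, rfl⟩, fun ⟨y, hy, hyx⟩ => hinj hyx ▸ hy⟩
  refine IsTriangular.hasStrictlyDecreasingJH (k := k) (e := e') (μ := μ)
    ⟨fun j hj S hS => ?_, fun j hj => ?_⟩ ?_ hanti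
  · rw [hflag j hj.le, map_smul, he' j hj] at hS
    exact h.indep j hj S hS
  · rw [hflag j hj.le, map_sub, map_smul, hf, he' j hj]
    exact h.a_sub_mem j hj
  · rw [eq_top_iff]
    intro x _
    rw [hflag k le_rfl, hrange]
    exact ⟨x, rfl⟩

/-! ### Semi-simplicity from a decreasing Jordan–Hölder sequence -/

/-- The equation `ρ T + b T' = S` has a solution when `ρ > 0`, as no `ρ + n` vanishes. -/
theorem exists_solution {ρ : ℚ} (hρ : 0 < ρ) (S : ℂ⟦X⟧) :
    ∃ T : ℂ⟦X⟧, C (ρ : ℂ) * T + X * derivative ℂ T = S := by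
  refine ⟨PowerSeries.mk fun n => coeff n S / (ρ + n), PowerSeries.ext fun n => ?_⟩
  have hne : ((ρ : ℂ) + n) ≠ 0 := by
    have : (ρ + n : ℚ) ≠ 0 := by positivity
    exact_mod_cast this
  rw [map_add, coeff_C_mul, coeff_X_mul_derivative, coeff_mk]
  field_simp

/-- Independent eigenvectors which span a submodule containing `b^m E` make `E` semi-simple: the
coordinates of `b^m x` define functionals with values in modules `E_c`. -/
theorem isSemiSimple_of_eigenvectors (hX : ∀ (n : ℕ) (x : E), (X ^ n : ℂ⟦X⟧) • x = 0 → x = 0)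
    {k : ℕ} (f : Fin k → E) (ν : Fin k → ℂ) (hli : LinearIndependent ℂ⟦X⟧ f)
    (hf : ∀ i, ABAction.a (f i) = (C (ν i) * X : ℂ⟦X⟧) • f i) (m : ℕ)
    (hspan : ∀ x : E, (X ^ m : ℂ⟦X⟧) • x ∈ Submodule.span ℂ⟦X⟧ (Set.range f)) :
    IsSemiSimple E := by
  let r : E →ₗ[ℂ⟦X⟧] (Fin k →₀ ℂ⟦X⟧) := hli.repr.comp
    ((LinearMap.lsmul ℂ⟦X⟧ E (X ^ m)).codRestrict _ hspan)
  have hr : ∀ x, ∑ i, r x i • f i = (X ^ m : ℂ⟦X⟧) • x := fun x => by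
    have := hli.linearCombination_repr ⟨_, hspan x⟩
    rw [Finsupp.linearCombination_apply, Finsupp.sum_fintype _ (fun i a => a • f i)
      (fun i => zero_smul _ _)] at this
    exact this
  refine isSemiSimple_of_functionals (fun i => ν i - m) (fun i => (Finsupp.lapply i).comp r)
    (fun i x => ?_) (fun x hx => ?_)
  · change r (ABAction.a x) i = rankOneA (ν i - m) (r x i)
    rw [← sub_eq_zero]
    refine Fintype.linearIndependent_iff.1 hli
      (fun i => r (ABAction.a x) i - rankOneA (ν i - m) (r x i)) ?_ i
    have h1 : ABAction.a (∑ i, r x i • f i) =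
        ∑ i, (rankOneA (ν i - m) (r x i) + C (m : ℂ) * X * r x i) • f i := by
      rw [map_sum]
      refine Finset.sum_congr rfl fun i _ => ?_
      rw [ABAction.a_smul, hf, smul_smul, ← add_smul, rankOneA_apply, map_sub]
      congr 1
      ring
    rw [hr, a_X_pow_smul, smul_add, ← hr (ABAction.a x), smul_comm, ← hr x, Finset.smul_sum] at h1
    simp only [add_smul, Finset.sum_add_distrib, smul_smul] at h1
    simp only [sub_smul, Finset.sum_sub_distrib]
    rw [sub_eq_zero]
    exact add_right_cancel h1
  · apply hX m
    rw [← hr x]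
    exact Finset.sum_eq_zero fun i _ => by
      have : r x i = 0 := hx i
      rw [this, zero_smul]

/-- The strict inequalities allow the construction of eigenvectors of `F_j` which span a
submodule containing `b^j F_j` (and even `b^{j-1} F_j`, which the induction uses): the vector
`b^j e`, where `e` generates `F_{j+1}` modulo `F_j`, satisfies `a (b^j e) = ν b (b^j e)` up to
multiples by `b` of the eigenvectors `f_i` found so far, with `ν = μ_{j+1} + j`; it is corrected by
solving one equation `(ν_i - ν) T + b T' = S` for each of them. -/
theorem HasStrictlyDecreasingJH.isSemiSimple
    (hX : ∀ (n : ℕ) (x : E), (X ^ n : ℂ⟦X⟧) • x = 0 → x = 0) (h : HasStrictlyDecreasingJH E) :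
    IsSemiSimple E := by
  obtain ⟨k, F, μ, hF, hiso, hanti⟩ := h
  have key : ∀ (j : ℕ) (hj : j < k + 1), ∃ (f : Fin j → E) (ν : Fin j → ℚ),
      LinearIndependent ℂ⟦X⟧ f ∧ (∀ i, f i ∈ (F ⟨j, hj⟩).toSubmodule) ∧
      (∀ i, ABAction.a (f i) = (C (ν i : ℂ) * X : ℂ⟦X⟧) • f i) ∧
      (∀ i, ∀ l : Fin k, j ≤ l → μ l + (l : ℕ) < ν i) ∧
      ∀ x ∈ (F ⟨j, hj⟩).toSubmodule, ∃ y ∈ Submodule.span ℂ⟦X⟧ (Set.range f),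
        (X ^ j : ℂ⟦X⟧) • x = (X : ℂ⟦X⟧) • y := by
    intro j
    induction j with
    | zero =>
      intro hj
      refine ⟨Fin.elim0, Fin.elim0, linearIndependent_empty_type, fun i => i.elim0,
        fun i => i.elim0, fun i => i.elim0, fun x hx => ⟨0, Submodule.zero_mem _, ?_⟩⟩
      have hx0 : x ∈ (F 0).toSubmodule := hx
      rw [hF.bot, Submodule.mem_bot] at hx0
      rw [hx0, smul_zero, smul_zero]
    | succ j ih =>
      intro hj
      have hjk : j < k := by omega
      obtain ⟨f, ν, hli, hfF, hfa, hν, hspan⟩ := ih (by omega)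
      obtain ⟨e, heF, hind, hgen, hea⟩ := exists_of_abIso_rankOne (hiso ⟨j, hjk⟩)
      change e ∈ (F ⟨j + 1, hj⟩).toSubmodule at heF
      change ∀ S : ℂ⟦X⟧, S • e ∈ (F ⟨j, _⟩).toSubmodule → S = 0 at hind
      change ∀ x ∈ (F ⟨j + 1, hj⟩).toSubmodule, ∃ S : ℂ⟦X⟧,
        x - S • e ∈ (F ⟨j, _⟩).toSubmodule at hgen
      change _ ∈ (F ⟨j, _⟩).toSubmodule at hea
      have hle : (F ⟨j, by omega⟩).toSubmodule ≤ (F ⟨j + 1, hj⟩).toSubmodule := hF.mono ⟨j, hjk⟩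
      set μj := μ ⟨j, hjk⟩ with hμj
      obtain ⟨y, hy, hye⟩ := hspan _ hea
      obtain ⟨c, rfl⟩ := (Submodule.mem_span_range_iff_exists_fun ℂ⟦X⟧).1 hy
      have hT : ∀ i, ∃ T : ℂ⟦X⟧, C ((ν i - (μj + j) : ℚ) : ℂ) * T + X * derivative ℂ T = -c i :=
        fun i => exists_solution (sub_pos.2 (hν i ⟨j, hjk⟩ le_rfl)) _
      choose T hT using hT
      set g := (X ^ j : ℂ⟦X⟧) • e with hg
      have hag : ABAction.a g = (X : ℂ⟦X⟧) • (∑ i, c i • f i) +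
          (C ((μj + j : ℚ) : ℂ) * X : ℂ⟦X⟧) • g := by
        rw [← hye, hg, a_X_pow_smul, smul_comm _ (X ^ j : ℂ⟦X⟧) e, ← smul_add]
        congr 1
        push_cast
        rw [map_add, add_mul, add_smul]
        abel
      have hsumF : ∀ S : Fin j → ℂ⟦X⟧, ∑ i, S i • f i ∈ (F ⟨j, by omega⟩).toSubmodule :=
        fun S => Submodule.sum_mem _ fun i _ => Submodule.smul_mem _ _ (hfF i)
      set f₀ := g + ∑ i, T i • f i with hf₀
      have hf₀a : ABAction.a f₀ = (C ((μj + j : ℚ) : ℂ) * X : ℂ⟦X⟧) • f₀ := by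
        rw [hf₀, map_add, hag, smul_add, map_sum, Finset.smul_sum, Finset.smul_sum,
          add_right_comm, add_comm, ← Finset.sum_add_distrib]
        congr 1
        refine Finset.sum_congr rfl fun i _ => ?_
        rw [ABAction.a_smul, hfa, smul_smul, smul_smul, smul_smul, ← add_smul, ← add_smul]
        congr 1
        have := hT i
        push_cast at this ⊢
        rw [map_sub] at this
        linear_combination X * this
      have hsub : Submodule.span ℂ⟦X⟧ (Set.range f) ≤
          Submodule.span ℂ⟦X⟧ (Set.range (Fin.cons f₀ f : Fin (j + 1) → E)) :=
        Submodule.span_mono (by rintro _ ⟨i, rfl⟩; exact ⟨i.succ, rfl⟩)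
      refine ⟨Fin.cons f₀ f, Fin.cons (μj + j) ν, ?_, ?_, ?_, ?_, ?_⟩
      · refine LinearIndependent.finCons' f₀ f hli fun S y hy hSy => ?_
        obtain ⟨d, hd⟩ := (Submodule.mem_span_range_iff_exists_fun ℂ⟦X⟧).1 hy
        have h1 : (S * X ^ j) • e ∈ (F ⟨j, by omega⟩).toSubmodule := by
          have h2 : (S * X ^ j) • e = -(S • (∑ i, T i • f i) + ∑ i, d i • f i) := by
            rw [eq_neg_iff_add_eq_zero, ← hSy, hd, hf₀, smul_add, hg, smul_smul]
            abel
          rw [h2]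
          exact Submodule.neg_mem _ (Submodule.add_mem _ (Submodule.smul_mem _ _ (hsumF T))
            (hsumF d))
        exact (mul_eq_zero.1 (hind _ h1)).resolve_right (pow_ne_zero j X_ne_zero)
      · rw [Fin.forall_fin_succ]
        exact ⟨Submodule.add_mem _ (Submodule.smul_mem _ _ heF) (hle (hsumF T)),
          fun i => hle (hfF i)⟩
      · rw [Fin.forall_fin_succ]
        exact ⟨hf₀a, hfa⟩
      · rw [Fin.forall_fin_succ]
        refine ⟨fun l hl => ?_, fun i l hl => hν i l (by omega)⟩
        have h1 := hanti (show (⟨j, hjk⟩ : Fin k) < l from Fin.lt_def.2 hl)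
        change μ l + ((l : ℕ) + 1 : ℚ) < μj + ((j : ℕ) + 1 : ℚ) at h1
        change μ l + (l : ℕ) < μj + j
        linarith
      · intro x hx
        obtain ⟨S, hS⟩ := hgen x hx
        obtain ⟨y', hy', hxy'⟩ := hspan _ hS
        refine ⟨S • f₀ - S • (∑ i, T i • f i) + (X : ℂ⟦X⟧) • y',
          Submodule.add_mem _ (Submodule.sub_mem _ (Submodule.smul_mem _ _
            (Submodule.subset_span ⟨0, rfl⟩)) (Submodule.smul_mem _ _ (hsub ?_)))
            (Submodule.smul_mem _ _ (hsub hy')), ?_⟩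
        · exact (Submodule.mem_span_range_iff_exists_fun ℂ⟦X⟧).2 ⟨T, rfl⟩
        · rw [← hxy', hf₀, smul_add S, add_sub_cancel_right, smul_sub, hg, pow_succ', mul_smul,
            smul_comm (X ^ j : ℂ⟦X⟧) S, add_sub_cancel]
  obtain ⟨f, ν, hli, -, hfa, -, hspan⟩ := key k (Nat.lt_succ_self k)
  refine isSemiSimple_of_eigenvectors hX f (fun i => (ν i : ℂ)) hli hfa k fun x => ?_
  have hx : x ∈ (F (Fin.last k)).toSubmodule := hF.top ▸ Submodule.mem_top
  obtain ⟨y, hy, hxy⟩ := hspan x hx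
  rw [hxy]
  exact Submodule.smul_mem _ _ hy

end JordanHolder

/-! ### Frescos -/

section Main

variable {E : Type u} [AddCommGroup E] [Module ℂ⟦X⟧ E] [ABAction E]

theorem IsFresco.exists_embedding (hE : IsFresco E) :
    ∃ (Λ : Finset ℚ) (N p : ℕ) (j : E →ₗ[ℂ⟦X⟧] XiSum Λ N p) (x : E),
      (∀ l ∈ Λ, 0 < l ∧ l ≤ 1) ∧ IsABLinear j ∧ Function.Injective j ∧
        (generatedBy x).toSubmodule = ⊤ := by
  obtain ⟨Λ, N, p, φ, hΛ, f, hf⟩ := hE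
  set j : E →ₗ[ℂ⟦X⟧] XiSum Λ N p :=
    (generatedBy φ).toSubmodule.subtype.comp (f : E →ₗ[ℂ⟦X⟧] _) with hjdef
  have hj : IsABLinear j := (isABLinear_subtype _).compose hf
  have hinj : Function.Injective j := Subtype.val_injective.comp f.injective
  set x := f.symm ⟨φ, mem_generatedBy_self φ⟩ with hx
  have hjx : j x = φ := congrArg Subtype.val (f.apply_symm_apply ⟨φ, mem_generatedBy_self φ⟩)
  refine ⟨Λ, N, p, j, x, hΛ, hj, hinj, ?_⟩
  have hle : (generatedBy φ).toSubmodule ≤ (generatedBy x).toSubmodule.map j := by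
    refine generatedBy_le ⟨x, mem_generatedBy_self x, hjx⟩ ?_
    rintro _ ⟨y, hy, rfl⟩
    exact ⟨ABAction.a y, (generatedBy x).a_mem y hy, hj y⟩
  rw [eq_top_iff]
  intro y _
  obtain ⟨z, hz, hzy⟩ := hle (f y).2
  exact hinj hzy ▸ hz

/-- A semi-simple fresco contains no logarithm, so that its `[l]`-primitive part is the common
kernel of the functionals with values in the other `E_{l'}`. It is therefore generated by one
element. -/
theorem hasStrictlyDecreasingJH_of_primitivePart (hE : IsFresco E) (hs : IsSemiSimple E)
    {l : ℚ} (h0 : 0 < l) (h1 : l ≤ 1) {E' : Type v} [AddCommGroup E'] [Module ℂ⟦X⟧ E']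
    [ABAction E'] {f : E' →ₗ[ℂ⟦X⟧] E} (hf : IsABLinear f) (hfi : Function.Injective f)
    (hrange : LinearMap.range f = (primitivePart E {l}).toSubmodule) :
    HasStrictlyDecreasingJH E' := by
  obtain ⟨Λ, N, p, j, x, hΛ, hj, hinj, hx⟩ := hE.exists_embedding
  have hlog := hs.logDeriv_comp_eq_zero hj
  have hg := noLogFunctional_a hj hlog
  obtain ⟨y, hy⟩ := exists_generatedBy_inf_iInf_ker
    (Finset.univ.filter fun i : Fin p × Λ => (i.2 : ℚ) ≠ l) hg x
  have hgen : (generatedBy y).toSubmodule = LinearMap.range f := by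
    ext z
    rw [hrange, hy, hx, mem_primitivePart_iff hj hinj h0 h1 hΛ]
    constructor
    · rintro ⟨-, hz⟩ q l' hl'
      funext k
      by_cases hk : k = 0
      · rw [hk]; exact hz (q, l') (Finset.mem_filter.2 ⟨Finset.mem_univ _, hl'⟩)
      · exact apply_eq_zero_of_logDeriv hlog z q l' hk
    · intro hz
      refine ⟨Submodule.mem_top, fun i hi => ?_⟩
      rw [noLogFunctional_apply, hz i.1 i.2 (Finset.mem_filter.1 hi).2]
      rfl
  obtain ⟨k, e, μ, htri, hflag, hanti, -⟩ := exists_isTriangular (c₀ := l) hg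
    (eq_zero_of_noLogFunctional hinj hlog) y 0
    (fun i hi => by
      by_contra hne
      refine hi (((hy y).1 (mem_generatedBy_self y)).2 i (Finset.mem_filter.2
        ⟨Finset.mem_univ _, fun h => hne ?_⟩))
      rw [h])
    (fun i => by rw [pow_zero]; exact one_dvd _)
  exact htri.hasStrictlyDecreasingJH_of_embedding hf hfi (hflag.trans hgen) hanti

theorem IsFresco.smul_X_pow_eq_zero (hE : IsFresco E) (n : ℕ) (x : E)
    (hx : (X ^ n : ℂ⟦X⟧) • x = 0) : x = 0 := by
  obtain ⟨Λ, N, p, j, -, -, -, hinj, -⟩ := hE.exists_embedding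
  apply hinj
  apply smul_X_pow_cancel (n := n)
  rw [← map_smul, hx, map_zero, smul_zero]

theorem IsFresco.isSemiSimple_of_primitivePart (hE : IsFresco E)
    (hs : ∀ l : ℚ, 0 < l → l ≤ 1 → IsSemiSimple (primitivePart E {l}).toSubmodule) :
    IsSemiSimple E := by
  obtain ⟨Λ, N, p, j, x, hΛ, hj, hinj, hx⟩ := hE.exists_embedding
  have hlog := logDeriv_comp_eq_zero_of_primitivePart hΛ hj hinj hs
  exact isSemiSimple_of_functionals _ (noLogFunctional j) (noLogFunctional_a hj hlog)
    (eq_zero_of_noLogFunctional hinj hlog)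

theorem IsFresco.primitivePart_eq_top (hE : IsFresco E) {l : ℚ} (h0 : 0 < l) (h1 : l ≤ 1)
    (hl : IsPrimitive E {l}) : (primitivePart E {l}).toSubmodule = ⊤ := by
  obtain ⟨Λ, N, p, j, -, hΛ, hj, hinj, -⟩ := hE.exists_embedding
  rw [eq_top_iff]
  intro x _
  rw [mem_primitivePart_iff hj hinj h0 h1 hΛ]
  exact hl.apply_eq_zero hj hinj h0 h1 hΛ x

end Main

end Fresco

end

theorem proposition2p4p4 {E : Type*} [AddCommGroup E] [Module (PowerSeries ℂ) E]
    [Fresco.ABAction E] (hE : Fresco.IsFresco E) :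
    (∀ l : ℚ, 0 < l → l ≤ 1 → Fresco.IsPrimitive E {l} →
      (Fresco.IsSemiSimple E ↔ Fresco.HasStrictlyDecreasingJH E)) ∧
    (Fresco.IsSemiSimple E ↔ ∀ l : ℚ, 0 < l → l ≤ 1 →
      Fresco.IsSemiSimple (Fresco.primitivePart E {l}).toSubmodule) ∧
    (Fresco.IsSemiSimple E ↔ ∀ l : ℚ, 0 < l → l ≤ 1 →
      Fresco.HasStrictlyDecreasingJH (Fresco.primitivePart E {l}).toSubmodule) := by
  have hX : ∀ (n : ℕ) (x : E), (X ^ n : ℂ⟦X⟧) • x = 0 → x = 0 := hE.smul_X_pow_eq_zero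
  refine ⟨fun l h0 h1 hl => ⟨fun hs => ?_, fun h => h.isSemiSimple hX⟩,
    ⟨fun hs l _ _ => ?_, hE.isSemiSimple_of_primitivePart⟩, fun hs l h0 h1 => ?_, fun h => ?_⟩
  · exact Fresco.hasStrictlyDecreasingJH_of_primitivePart hE hs h0 h1 (f := LinearMap.id)
      (fun _ => rfl) Function.injective_id
      (LinearMap.range_id.trans (hE.primitivePart_eq_top h0 h1 hl).symm)
  · exact hs.of_injective (Fresco.isABLinear_subtype _) Subtype.val_injective
  · exact Fresco.hasStrictlyDecreasingJH_of_primitivePart hE hs h0 h1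
      (Fresco.isABLinear_subtype _) Subtype.val_injective (Submodule.range_subtype _)
  · exact hE.isSemiSimple_of_primitivePart fun l h0 h1 => (h l h0 h1).isSemiSimple
      fun n x hx => Subtype.ext (hX n x (congrArg Subtype.val hx))
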